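/- **Conventions.** For probability distributions $P,Q$, the trade-off function is $T(P,Q)(\alpha)=\inf\{\beta_{\mathcal R}:\alpha_{\mathcal R}\le\alpha\}$, $\alpha\in[0,1]$, the infimum being over all (possibly randomized) rejection rules $\mathcal R$ for $H_0:P$ against $H_1:Q$, with type I error $\alpha_{\mathcal R}$ and type II error $\beta_{\mathcal R}$. Put $\mathrm{ID}(\alpha)=1-\alpha$ and $G_\mu=T(\mathcal N(0,1),\mathcal N(\mu,1))$. Let $n\ge 1$, $N\ge 0$, $0\le q\le 1$, $C>0$, $\sigma>0$, and let each data point $d$ have an information vector $g(d)\in\mathbb R^n$ with clipped version $\bar g(d)=g(d)/\max(1,\|g(d)\|_2/C)$. On a dataset $D=(d_1,\dots,d_M)$, the mechanism FEASGM $\mathcal M$ samples $B\subseteq\{1,\dots,M\}$ by including each index independently with probability $q$, draws $G\sim\mathcal N(0,\sigma^2C^2 I_n)$ independently, and outputs $$\frac{\sum_{i\in B}\bar g(d_i)+G}{\lfloor Mq\rfloor},$$ where the denominator is replaced by $1$ if $\lfloor Mq\rfloor=0$. A trade-off function $f$ is called a *privacy guarantee for sizes $(N,N+1)$* if $T(\mathcal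 M(D),\mathcal M(D'))(\alpha)\ge f(\alpha)$ for all $\alpha\in[0,1]$ and all $D=(d_1,\dots,d_N)$ and $D'=(d_1,\dots,d_N,d_{N+1})$. **Theorem (privacy guarantee of FEASGM).** 1. If $\lfloor Nq\rfloor=\lfloor (N+1)q\rfloor$, then $q\,G_{1/\sigma}+(1-q)\,\mathrm{ID}$ (the guarantee of the subsampled Gaussian mechanism) is a privacy guarantee for sizes $(N,N+1)$. 2. Suppose $\lfloor Nq\rfloor=K$ and $\lfloor (N+1)q\rfloor=K+1$. For $B\subseteq\{1,\dots,N\}$ let $P(B)=q^{|B|}(1-q)^{N-|B|}$, $$\overline\mu_B^1=\frac{|B|}{(K+1)\sigma},\qquad \overline\mu_B^2=\frac{K+|B|}{(K+1)\sigma},\qquad \underline{f_B^j}=T\bigl(P^{\otimes n},\,Q_K^{\otimes(n-1)}\otimes Q_K^{\overline\mu_B^j}\bigr)\quad(j=1,2),$$ where $P=\mathcal N(0,1)$, $Q_K^{\mu}=\mathcal N\bigl(\mu,(K/(K+1))^2\bigr)$ and $Q_K=Q_K^0$ (for $K=0$, $\mathcal N(\mu,0)$ is the point mass at $\mu$). For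 $t\ge0$ and $c\in[0,1]$ let $$\alpha_B^j(t,c)=\Pr_{X\sim P^{\otimes n}}[L_B^j(X)>t]+c\,\Pr_{X\sim P^{\otimes n}}[L_B^j(X)=t]$$ be the type I error of the likelihood ratio test for the pair defining $\underline{f_B^j}$, where $L_B^j$ is the Radon–Nikodym derivative of (the absolutely continuous part of) $Q_K^{\otimes(n-1)}\otimes Q_K^{\overline\mu_B^j}$ with respect to $P^{\otimes n}$, that is, the ratio of the two densities if $K\ge1$. Let $$\alpha(t,c)=\sum_B P(B)\bigl[(1-q)\,\alpha_B^1(t,c)+q\,\alpha_B^2(t,c)\bigr].$$ Then $\alpha(t,c)$ takes every value in $[0,1]$, and there is a trade-off function $\underline f$, which is therefore unique on $[0,1]$, with $$\underline f(\alpha(t,c))=\sum_{B}P(B)\bigl[(1-q)\,\underline{f_B^1}(\alpha_B^1(t,c))+q\,\underline{f_B^2}(\alpha_B^2(t,c))\bigr]\qquad\text{for all } t\ge 0,\ c\in[0,1];$$ and $\underline f$ is a privacy guarantee for sizes $(N,N+1)$. -/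

import Mathlib

open MeasureTheory ProbabilityTheory

noncomputable section

/-- The trade-off function `T(P, Q)`: the least type II error among all (possibly randomized)
rejection rules for `H₀ : P` against `H₁ : Q` whose type I error is at most `α`.
A rule is given by its probability `φ y` of rejecting `H₀` after observing `y`. -/
def tradeOff {Y : Type*} [MeasurableSpace Y] (P Q : Measure Y) (α : ℝ) : ℝ :=
  sInf {β : ℝ | ∃ φ : Y → ℝ, Measurable φ ∧ (∀ y, 0 ≤ φ y ∧ φ y ≤ 1) ∧
    ∫ y, φ y ∂P ≤ α ∧ β = ∫ y, (1 - φ y) ∂Q}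

/-- `f` is (on `[0, 1]`) the trade-off function of some pair of probability distributions. -/
def IsTradeOffFunction (f : ℝ → ℝ) : Prop :=
  ∃ (Y : Type) (_ : MeasurableSpace Y) (P Q : Measure Y),
    IsProbabilityMeasure P ∧ IsProbabilityMeasure Q ∧
      ∀ α ∈ Set.Icc (0 : ℝ) 1, f α = tradeOff P Q α

/-- The Gaussian trade-off function `G_μ = T(N(0,1), N(μ,1))`. -/
def gaussianTradeOff (μ : ℝ) : ℝ → ℝ :=
  tradeOff (gaussianReal 0 1) (gaussianReal μ 1)

/-- The identical trade-off function `ID`. -/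
def idTradeOff (α : ℝ) : ℝ := 1 - α

/-- A mechanism gives, for each dataset of each size `N`, the law of its output.  The trade-off
function `f` is a privacy guarantee for the ordered neighbouring pairs `(D, D ∪ {d})`, `|D| = N`. -/
def IsPrivacyGuarantee {X Y : Type*} [MeasurableSpace Y]
    (M : (N : ℕ) → (Fin N → X) → Measure Y) (N : ℕ) (f : ℝ → ℝ) : Prop :=
  IsTradeOffFunction f ∧
    ∀ (D : Fin N → X) (d : X), ∀ α ∈ Set.Icc (0 : ℝ) 1,
      f α ≤ tradeOff (M N D) (M (N + 1) (Fin.snoc D d)) α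

/-- Clipping to norm at most `C`. -/
def clip {n : ℕ} (C : ℝ) (v : EuclideanSpace ℝ (Fin n)) : EuclideanSpace ℝ (Fin n) :=
  (max 1 (‖v‖ / C))⁻¹ • v

/-- The isotropic Gaussian law `N(0, s² I)` on `ℝⁿ`. -/
def gaussianNoise (n : ℕ) (s : ℝ) : Measure (EuclideanSpace ℝ (Fin n)) :=
  (Measure.pi fun _ : Fin n => gaussianReal 0 (s ^ 2).toNNReal).map (WithLp.toLp 2)

/-- The probability that Poisson sampling with rate `q` from `N` points selects the batch `B`. -/
def batchProb {N : ℕ} (q : ℝ) (B : Finset (Fin N)) : ℝ :=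
  q ^ B.card * (1 - q) ^ (N - B.card)

/-- The normalization factor `⌊N q⌋`, replaced by `1` if it is `0`. -/
def floorFactor (q : ℝ) (N : ℕ) : ℝ := (max ⌊(N : ℝ) * q⌋₊ 1 : ℕ)

/-- The law of the output of FEASGM on the dataset `D`: a Poisson-sampled batch `B`, the sum of the
clipped vectors `g (D i)`, `i ∈ B`, plus noise `N(0, σ² C² I)`, divided by the factor `⌊N q⌋`. -/
def feasgm {X : Type*} {n : ℕ} (q C σ : ℝ) (g : X → EuclideanSpace ℝ (Fin n))
    (N : ℕ) (D : Fin N → X) : Measure (EuclideanSpace ℝ (Fin n)) :=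
  ∑ B : Finset (Fin N), ENNReal.ofReal (batchProb q B) •
    (gaussianNoise n (σ * C)).map
      (fun G => (floorFactor q N)⁻¹ • ((∑ i ∈ B, clip C (g (D i))) + G))

/-- `P^{⊗ n}` with `P = N(0, 1)`. -/
def stdProd (n : ℕ) : Measure (Fin n → ℝ) :=
  Measure.pi fun _ => gaussianReal 0 1

/-- `Q_K^{⊗ (n-1)} ⊗ Q_K^μ` with `Q_K^μ = N(μ, (K/(K+1))²)` and `Q_K = Q_K^0`. -/
def shiftProd (n K : ℕ) (μ : ℝ) : Measure (Fin n → ℝ) :=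
  Measure.pi fun i => gaussianReal (if (i : ℕ) + 1 = n then μ else 0)
    (((K : NNReal) / ((K : NNReal) + 1)) ^ 2)

/-- The type I error of the likelihood ratio test of `P` against `Q` with threshold `t` that
rejects with probability `c` on ties; `dQ/dP` is the ratio of the densities. -/
def lrTypeI {Y : Type*} [MeasurableSpace Y] (P Q : Measure Y) (t c : ℝ) : ℝ :=
  P.real {y | t < (Q.rnDeriv P y).toReal} + c * P.real {y | (Q.rnDeriv P y).toReal = t}

/-- The bound `|B| / ((K+1) σ)` on the shift if the added point is not sampled. -/
def muBar1 {N : ℕ} (K : ℕ) (σ : ℝ) (B : Finset (Fin N)) : ℝ :=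
  (B.card : ℝ) / (((K : ℝ) + 1) * σ)

/-- The bound `(K+|B|) / ((K+1) σ)` on the shift if the added point is sampled. -/
def muBar2 {N : ℕ} (K : ℕ) (σ : ℝ) (B : Finset (Fin N)) : ℝ :=
  ((K : ℝ) + B.card) / (((K : ℝ) + 1) * σ)

/-- The mixture `α(t,c) = ∑_B P(B) [(1-q) α_B¹(t,c) + q α_B²(t,c)]` of the type I errors. -/
def mixAlpha (n N K : ℕ) (q σ t c : ℝ) : ℝ :=
  ∑ B : Finset (Fin N), batchProb q B *
    ((1 - q) * lrTypeI (stdProd n) (shiftProd n K (muBar1 K σ B)) t c +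
      q * lrTypeI (stdProd n) (shiftProd n K (muBar2 K σ B)) t c)

/-- `∑_B P(B) [(1-q) f_B¹(α_B¹(t,c)) + q f_B²(α_B²(t,c))]`, where
`f_Bʲ = T(P^{⊗ n}, Q_K^{⊗ (n-1)} ⊗ Q_K^{μ_Bʲ})`. -/
def mixBeta (n N K : ℕ) (q σ t c : ℝ) : ℝ :=
  ∑ B : Finset (Fin N), batchProb q B *
    ((1 - q) * tradeOff (stdProd n) (shiftProd n K (muBar1 K σ B))
        (lrTypeI (stdProd n) (shiftProd n K (muBar1 K σ B)) t c) +
      q * tradeOff (stdProd n) (shiftProd n K (muBar2 K σ B))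
        (lrTypeI (stdProd n) (shiftProd n K (muBar2 K σ B)) t c))

end

/-! Fix a test of the mechanism's output. Its type I error is the average over the batches `B` of
its type I errors against Gaussian components. On the larger dataset each `B` splits according to
whether the added point is sampled, so everything reduces to comparing two isotropic Gaussians per
batch and then mixing.

With equal normalization factors, an unsampled added point leaves the component unchanged, and a
sampled one shifts the mean by at most `1 / σ` standard deviations. The test for this shift is no
easier than the one-dimensional one (`gaussianTradeOff_le_gaussianShift`), and convexity of
`G_{1/σ}` (`tradeOff_sum_le`) handles the average over `B`.

When the factor passes from `K ≥ 1` to `K + 1`, standardizing the null component leaves `N(0, I)`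
against `N(v, τ² I)` with `τ = K / (K + 1)` and `‖v‖` at most the stated shift. Replacing `v` by a
vector of maximal norm makes testing easier (`tradeOff_gaussianShift_le_of_norm_le`): likelihood
ratio tests reject on balls whose centre lies beyond `v`, and moving the mean towards the centre
raises the power. Revealing `B` and the sampling of the added point helps the tester further, so the
trade-off function of the mixture with observed index is a guarantee. By Neyman–Pearson with `t` as
Lagrange multiplier, its optimal tests use the same threshold in every component
(`tradeOff_mixture_lrTypeI`), which is the implicit equation for `f`. For `K = 0` the alternatives
are point masses and the bound is zero. -/

/-- A randomized rejection rule: a measurable function with values in `[0, 1]`. -/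
structure IsTest {Y : Type*} [MeasurableSpace Y] (φ : Y → ℝ) : Prop where
  measurable : Measurable φ
  mem : ∀ y, 0 ≤ φ y ∧ φ y ≤ 1

namespace IsTest

variable {Y : Type*} [MeasurableSpace Y] {φ : Y → ℝ}

lemma integrable (h : IsTest φ) (P : Measure Y) [IsFiniteMeasure P] : Integrable φ P :=
  Integrable.of_bound h.measurable.aestronglyMeasurable 1
    (ae_of_all _ fun y => by rw [Real.norm_eq_abs, abs_le]; constructor <;> linarith [h.mem y])

lemma one_sub (h : IsTest φ) : IsTest (fun y => 1 - φ y) :=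
  ⟨h.measurable.const_sub 1, fun y => by constructor <;> linarith [h.mem y]⟩

lemma integral_nonneg (h : IsTest φ) (P : Measure Y) : 0 ≤ ∫ y, φ y ∂P :=
  MeasureTheory.integral_nonneg fun y => (h.mem y).1

lemma integral_one_sub (h : IsTest φ) (P : Measure Y) [IsProbabilityMeasure P] :
    ∫ y, (1 - φ y) ∂P = 1 - ∫ y, φ y ∂P := by
  rw [integral_sub (integrable_const _) (h.integrable P)]; simp

lemma integral_le_one (h : IsTest φ) (P : Measure Y) [IsProbabilityMeasure P] :
    ∫ y, φ y ∂P ≤ 1 := by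
  have := h.one_sub.integral_nonneg P
  rw [h.integral_one_sub] at this; linarith

lemma comp {Z : Type*} [MeasurableSpace Z] (h : IsTest φ) {g : Z → Y} (hg : Measurable g) :
    IsTest (fun z => φ (g z)) :=
  ⟨h.measurable.comp hg, fun _ => h.mem _⟩

end IsTest

/-! ### Trade-off functions: monotonicity, data processing, independent noise. -/

section TradeOff

variable {Y : Type*} [MeasurableSpace Y] {P Q : Measure Y} {α : ℝ}

lemma tradeOff_le {φ : Y → ℝ} (hφ : IsTest φ) (h : ∫ y, φ y ∂P ≤ α) :
    tradeOff P Q α ≤ ∫ y, (1 - φ y) ∂Q := by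
  refine csInf_le ⟨0, ?_⟩ ⟨φ, hφ.measurable, hφ.mem, h, rfl⟩
  rintro _ ⟨ψ, hψ, hψ', -, rfl⟩
  exact (IsTest.mk hψ hψ').one_sub.integral_nonneg Q

lemma tradeOff_set_nonempty (hα : 0 ≤ α) :
    {β : ℝ | ∃ φ : Y → ℝ, Measurable φ ∧ (∀ y, 0 ≤ φ y ∧ φ y ≤ 1) ∧
      ∫ y, φ y ∂P ≤ α ∧ β = ∫ y, (1 - φ y) ∂Q}.Nonempty :=
  ⟨_, fun _ => 0, measurable_const, fun _ => ⟨le_rfl, zero_le_one⟩, by simpa using hα, rfl⟩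

lemma le_tradeOff {b : ℝ} (hα : 0 ≤ α)
    (h : ∀ φ : Y → ℝ, IsTest φ → ∫ y, φ y ∂P ≤ α → b ≤ ∫ y, (1 - φ y) ∂Q) :
    b ≤ tradeOff P Q α := by
  refine le_csInf (tradeOff_set_nonempty hα) ?_
  rintro _ ⟨ψ, hψ, hψ', h', rfl⟩
  exact h ψ ⟨hψ, hψ'⟩ h'

lemma exists_test_lt (hα : 0 ≤ α) {ε : ℝ} (hε : 0 < ε) :
    ∃ φ : Y → ℝ, IsTest φ ∧ ∫ y, φ y ∂P ≤ α ∧ ∫ y, (1 - φ y) ∂Q < tradeOff P Q α + ε := by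
  obtain ⟨_, ⟨φ, hφ, hφ', h, rfl⟩, h'⟩ := exists_lt_of_csInf_lt
    (tradeOff_set_nonempty (P := P) (Q := Q) hα)
    (show tradeOff P Q α < tradeOff P Q α + ε by linarith)
  exact ⟨φ, ⟨hφ, hφ'⟩, h, h'⟩

lemma tradeOff_nonneg (hα : 0 ≤ α) : 0 ≤ tradeOff P Q α :=
  le_tradeOff hα fun _ hφ _ => hφ.one_sub.integral_nonneg Q

lemma tradeOff_antitone {α' : ℝ} (hα : 0 ≤ α) (h : α ≤ α') :
    tradeOff P Q α' ≤ tradeOff P Q α :=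
  le_tradeOff hα fun _ hφ h' => tradeOff_le hφ (h'.trans h)

/-- Data processing: a test of the image pulls back along `F` with the same errors. -/
lemma tradeOff_map_le {Z : Type*} [MeasurableSpace Z] {F : Y → Z} (hF : Measurable F)
    (hα : 0 ≤ α) : tradeOff P Q α ≤ tradeOff (P.map F) (Q.map F) α := by
  refine le_tradeOff hα fun φ hφ h => ?_
  rw [integral_map hF.aemeasurable hφ.measurable.aestronglyMeasurable] at h
  rw [integral_map hF.aemeasurable hφ.one_sub.measurable.aestronglyMeasurable]
  exact tradeOff_le (hφ.comp hF) h

lemma tradeOff_map_equiv {Z : Type*} [MeasurableSpace Z] (e : Y ≃ᵐ Z) (hα : 0 ≤ α) :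
    tradeOff (P.map e) (Q.map e) α = tradeOff P Q α := by
  refine le_antisymm ?_ (tradeOff_map_le e.measurable hα)
  have := tradeOff_map_le (P := P.map e) (Q := Q.map e) e.symm.measurable hα
  rwa [e.map_symm_map, e.map_symm_map] at this

/-- Independent noise is useless to the tester: averaging a test over `ρ` gives a test on `Y` with
the same errors. -/
lemma tradeOff_prod_le {Z : Type*} [MeasurableSpace Z] [IsFiniteMeasure P] [IsFiniteMeasure Q]
    (ρ : Measure Z) [IsProbabilityMeasure ρ] (hα : 0 ≤ α) :
    tradeOff P Q α ≤ tradeOff (P.prod ρ) (Q.prod ρ) α := by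
  refine le_tradeOff hα fun (φ : Y × Z → ℝ) hφ h => ?_
  have hψ : IsTest (fun y => ∫ z, φ (y, z) ∂ρ) :=
    ⟨(hφ.measurable.stronglyMeasurable.integral_prod_right').measurable, fun y =>
      ⟨(hφ.comp measurable_prodMk_left).integral_nonneg ρ,
        (hφ.comp measurable_prodMk_left).integral_le_one ρ⟩⟩
  rw [integral_prod _ (hφ.integrable _)] at h
  rw [integral_prod _ (hφ.one_sub.integrable _)]
  convert tradeOff_le hψ h using 3 with y
  exact (hφ.comp measurable_prodMk_left).integral_one_sub ρ

/-- A test of type I error at most `α` can be enlarged to one of type I error exactly `α`. -/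
lemma exists_test_lt_of_eq [IsProbabilityMeasure P] [IsFiniteMeasure Q]
    (hα : α ∈ Set.Icc (0 : ℝ) 1) {ε : ℝ} (hε : 0 < ε) :
    ∃ φ : Y → ℝ, IsTest φ ∧ ∫ y, φ y ∂P = α ∧ ∫ y, (1 - φ y) ∂Q < tradeOff P Q α + ε := by
  obtain ⟨φ, hφ, h, h'⟩ := exists_test_lt (P := P) (Q := Q) hα.1 hε
  set a := ∫ y, φ y ∂P with ha
  -- Interpolate between `φ` and the test that always rejects. If `a = 1` then `α = 1` and nothing
  -- has to be added.
  obtain ⟨l, hl, hla⟩ : ∃ l ∈ Set.Icc (0 : ℝ) 1, a + l * (1 - a) = α := by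
    rcases (hφ.integral_le_one P).lt_or_eq with h1 | h1
    · have : 0 < 1 - a := by linarith
      refine ⟨(α - a) / (1 - a), ⟨by apply div_nonneg <;> linarith, ?_⟩, by field_simp; ring⟩
      rw [div_le_one this]; linarith [hα.2]
    · exact ⟨0, by simp, by linarith [hα.2]⟩
  have hψ : IsTest (fun y => φ y + l * (1 - φ y)) := by
    refine ⟨by have := hφ.measurable; fun_prop, fun y => ?_⟩
    have := hφ.mem y
    constructor <;> nlinarith [hl.1, hl.2]
  refine ⟨_, hψ, ?_, lt_of_le_of_lt ?_ h'⟩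
  · rw [integral_add (hφ.integrable P) ((hφ.one_sub.integrable P).const_mul l),
      integral_const_mul, hφ.integral_one_sub, hla]
  · refine integral_mono (hψ.one_sub.integrable _) (hφ.one_sub.integrable _) fun y => ?_
    have := hφ.mem y
    have := mul_nonneg hl.1 (sub_nonneg.2 this.2)
    simp only; linarith

end TradeOff

/-! ### Finite mixtures, with and without observed index; convexity. -/

section Mixture

variable {ι Y : Type*} [Fintype ι] [MeasurableSpace Y]

lemma integral_sum_ofReal_smul {w : ι → ℝ} (hw : ∀ i, 0 ≤ w i) (P : ι → Measure Y)
    [∀ i, IsFiniteMeasure (P i)] {φ : Y → ℝ} (hφ : IsTest φ) :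
    ∫ y, φ y ∂(∑ i, ENNReal.ofReal (w i) • P i) = ∑ i, w i * ∫ y, φ y ∂(P i) := by
  rw [integral_finsetSum_measure]
  · refine Finset.sum_congr rfl fun i _ => ?_
    rw [integral_smul_measure, ENNReal.toReal_ofReal (hw i), smul_eq_mul]
  · exact fun i _ => (hφ.integrable (P i)).smul_measure ENNReal.ofReal_ne_top

lemma isProbabilityMeasure_sum_ofReal_smul {w : ι → ℝ} (hw : ∀ i, 0 ≤ w i) (hw1 : ∑ i, w i = 1)
    (P : ι → Measure Y) [∀ i, IsProbabilityMeasure (P i)] :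
    IsProbabilityMeasure (∑ i, ENNReal.ofReal (w i) • P i) := by
  constructor
  simp only [Measure.coe_finsetSum, Finset.sum_apply, Measure.smul_apply, measure_univ,
    smul_eq_mul, mul_one]
  rw [← ENNReal.ofReal_sum_of_nonneg fun i _ => hw i, hw1, ENNReal.ofReal_one]

/-- The joint law of an index `i` drawn with probability `w i` and a point drawn from `P i`. -/
noncomputable def mixture [MeasurableSpace ι] (w : ι → ℝ) (P : ι → Measure Y) : Measure (ι × Y) :=
  ∑ i, ENNReal.ofReal (w i) • (P i).map (Prod.mk i)

variable [MeasurableSpace ι]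

lemma integral_mixture [DiscreteMeasurableSpace ι] {w : ι → ℝ} (hw : ∀ i, 0 ≤ w i)
    (P : ι → Measure Y) [∀ i, IsProbabilityMeasure (P i)] {φ : ι × Y → ℝ} (hφ : IsTest φ) :
    ∫ y, φ y ∂(mixture w P) = ∑ i, w i * ∫ y, φ (i, y) ∂(P i) := by
  have (i : ι) : IsProbabilityMeasure ((P i).map (Prod.mk i)) :=
    Measure.isProbabilityMeasure_map measurable_prodMk_left.aemeasurable
  rw [mixture, integral_sum_ofReal_smul hw _ hφ]
  refine Finset.sum_congr rfl fun i _ => ?_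
  rw [integral_map measurable_prodMk_left.aemeasurable hφ.measurable.aestronglyMeasurable]

lemma isTest_uncurry [DiscreteMeasurableSpace ι] {φ : ι → Y → ℝ} (hφ : ∀ i, IsTest (φ i)) :
    IsTest (fun p : ι × Y => φ p.1 p.2) :=
  ⟨measurable_from_prod_countable_right fun i => (hφ i).measurable, fun p => (hφ p.1).mem p.2⟩

lemma isProbabilityMeasure_mixture [DiscreteMeasurableSpace ι] {w : ι → ℝ} (hw : ∀ i, 0 ≤ w i)
    (hw1 : ∑ i, w i = 1) (P : ι → Measure Y) [∀ i, IsProbabilityMeasure (P i)] :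
    IsProbabilityMeasure (mixture w P) :=
  have (i : ι) : IsProbabilityMeasure ((P i).map (Prod.mk i)) :=
    Measure.isProbabilityMeasure_map measurable_prodMk_left.aemeasurable
  isProbabilityMeasure_sum_ofReal_smul hw hw1 fun i => (P i).map (Prod.mk i)

/-- The trade-off function of a mixture with observed index is at most the mixture of the
trade-off functions, for any distribution of the type I error among the components. -/
lemma tradeOff_mixture_le [DiscreteMeasurableSpace ι] {w : ι → ℝ} (hw : ∀ i, 0 ≤ w i)
    (P Q : ι → Measure Y) [∀ i, IsProbabilityMeasure (P i)] [∀ i, IsProbabilityMeasure (Q i)]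
    {a : ι → ℝ} (ha : ∀ i, 0 ≤ a i) {α : ℝ} (h : ∑ i, w i * a i ≤ α) :
    tradeOff (mixture w P) (mixture w Q) α ≤ ∑ i, w i * tradeOff (P i) (Q i) (a i) := by
  refine le_of_forall_pos_le_add fun ε hε => ?_
  set S := ∑ i, w i
  have hS : 0 ≤ S := Finset.sum_nonneg fun i _ => hw i
  have hδ : 0 < ε / (S + 1) := by positivity
  choose φ hφ h1 h2 using fun i => exists_test_lt (P := P i) (Q := Q i) (ha i) hδ
  have hT := isTest_uncurry hφ
  refine (tradeOff_le hT ?_).trans ?_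
  · rw [integral_mixture hw _ hT]
    exact (Finset.sum_le_sum fun i _ => mul_le_mul_of_nonneg_left (h1 i) (hw i)).trans h
  · rw [integral_mixture hw _ hT.one_sub]
    refine (Finset.sum_le_sum fun i _ =>
      mul_le_mul_of_nonneg_left (h2 i).le (hw i)).trans ?_
    simp only [mul_add, Finset.sum_add_distrib, ← Finset.sum_mul]
    gcongr
    rw [mul_div_assoc', div_le_iff₀ (by positivity)]
    nlinarith

/-- Trade-off functions are convex. -/
lemma tradeOff_sum_le [DiscreteMeasurableSpace ι] {w : ι → ℝ} (hw : ∀ i, 0 ≤ w i)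
    (hw1 : ∑ i, w i = 1) (P Q : Measure Y) [IsProbabilityMeasure P] [IsProbabilityMeasure Q]
    {a : ι → ℝ} (ha : ∀ i, 0 ≤ a i) :
    tradeOff P Q (∑ i, w i * a i) ≤ ∑ i, w i * tradeOff P Q (a i) := by
  refine le_trans ?_ (tradeOff_mixture_le hw (fun _ => P) (fun _ => Q) ha le_rfl)
  refine le_tradeOff (Finset.sum_nonneg fun i _ => mul_nonneg (hw i) (ha i)) fun φ hφ h => ?_
  have hφi (i : ι) : IsTest fun y => φ (i, y) := hφ.comp measurable_prodMk_left
  -- All components have the same pair of laws, so the index carries no information and a test may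
  -- be averaged over it.
  have hψ : IsTest (fun y => ∑ i, w i * φ (i, y)) := by
    refine ⟨Finset.measurable_sum _ fun i _ => (hφi i).measurable.const_mul _, fun y =>
      ⟨Finset.sum_nonneg fun i _ => mul_nonneg (hw i) (hφ.mem _).1, ?_⟩⟩
    rw [← hw1]
    exact Finset.sum_le_sum fun i _ => mul_le_of_le_one_right (hw i) (hφ.mem _).2
  have hψi (ρ : Measure Y) [IsProbabilityMeasure ρ] :
      ∫ y, ∑ i, w i * φ (i, y) ∂ρ = ∫ p, φ p ∂(mixture w fun _ => ρ) := by
    rw [integral_mixture hw _ hφ, integral_finsetSum _ fun i _ => ((hφi i).integrable ρ).const_mul _]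
    simp only [integral_const_mul]
  refine (tradeOff_le hψ ((hψi P).trans_le h)).trans_eq ?_
  have := isProbabilityMeasure_mixture hw hw1 fun _ => Q
  rw [hψ.integral_one_sub, hψi, ← hφ.integral_one_sub]

end Mixture

/-! ### Likelihood ratio tests and their attainable type I errors. -/

section NeymanPearson

variable {Y : Type*} [MeasurableSpace Y] {P Q : Measure Y} {t c : ℝ}

open scoped Classical in
/-- The likelihood ratio test with threshold `t` that rejects with probability `c` on ties. -/
noncomputable def lrTest (P Q : Measure Y) (t c : ℝ) (y : Y) : ℝ :=
  if t < (Q.rnDeriv P y).toReal then 1 else if (Q.rnDeriv P y).toReal = t then c else 0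

lemma measurable_toReal_rnDeriv : Measurable fun y => (Q.rnDeriv P y).toReal :=
  (Measure.measurable_rnDeriv Q P).ennreal_toReal

lemma isTest_lrTest (hc : c ∈ Set.Icc (0 : ℝ) 1) : IsTest (lrTest P Q t c) := by
  have hm := measurable_toReal_rnDeriv (P := P) (Q := Q)
  refine ⟨Measurable.ite (measurableSet_lt measurable_const hm) measurable_const
    (Measurable.ite (measurableSet_eq_fun hm measurable_const) measurable_const
      measurable_const), fun y => ?_⟩
  unfold lrTest
  split_ifs <;> first | exact hc | norm_num

lemma integral_lrTest [IsFiniteMeasure P] : ∫ y, lrTest P Q t c y ∂P = lrTypeI P Q t c := by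
  have hm := measurable_toReal_rnDeriv (P := P) (Q := Q)
  have h1 : MeasurableSet {y | t < (Q.rnDeriv P y).toReal} := measurableSet_lt measurable_const hm
  have h2 : MeasurableSet {y | (Q.rnDeriv P y).toReal = t} :=
    measurableSet_eq_fun hm measurable_const
  have : lrTest P Q t c = fun y => {y | t < (Q.rnDeriv P y).toReal}.indicator (fun _ => 1) y +
      c * {y | (Q.rnDeriv P y).toReal = t}.indicator (fun _ => (1 : ℝ)) y := by
    ext y
    simp only [lrTest, Set.indicator_apply, Set.mem_ofPred_eq]
    split_ifs <;> linarith
  rw [this, integral_add ((integrable_const _).indicator h1)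
    (((integrable_const _).indicator h2).const_mul c), integral_const_mul,
    integral_indicator_const _ h1, integral_indicator_const _ h2, lrTypeI]
  simp

lemma lrTypeI_mem_Icc [IsProbabilityMeasure P] (hc : c ∈ Set.Icc (0 : ℝ) 1) :
    lrTypeI P Q t c ∈ Set.Icc (0 : ℝ) 1 := by
  rw [← integral_lrTest]
  exact ⟨(isTest_lrTest hc).integral_nonneg P, (isTest_lrTest hc).integral_le_one P⟩

/-- The Neyman–Pearson lemma, in Lagrangian form. -/
lemma integral_lrTest_add_le [IsProbabilityMeasure P] [IsProbabilityMeasure Q] (hQ : Q ≪ P)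
    (hc : c ∈ Set.Icc (0 : ℝ) 1) {φ : Y → ℝ} (hφ : IsTest φ) :
    ∫ y, (1 - lrTest P Q t c y) ∂Q + t * lrTypeI P Q t c ≤
      ∫ y, (1 - φ y) ∂Q + t * ∫ y, φ y ∂P := by
  have hL := isTest_lrTest (P := P) (Q := Q) (t := t) hc
  have key {ψ : Y → ℝ} (hψ : IsTest ψ) :
      ∫ y, (1 - ψ y) ∂Q = 1 - ∫ y, (Q.rnDeriv P y).toReal * ψ y ∂P ∧
      Integrable (fun y => (Q.rnDeriv P y).toReal * ψ y) P := by
    refine ⟨?_, (integrable_rnDeriv_smul_iff hQ).2 (hψ.integrable Q)⟩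
    rw [hψ.integral_one_sub, ← integral_rnDeriv_smul hQ]
    simp only [smul_eq_mul]
  rw [← integral_lrTest, (key hL).1, (key hφ).1, ← integral_const_mul, ← integral_const_mul]
  -- With `L = dQ/dP`, the integrand is `(L - t) * (lrTest - φ)`: both factors have the same sign,
  -- and ties contribute zero.
  have h1 : 0 ≤ ∫ y, (((Q.rnDeriv P y).toReal * lrTest P Q t c y - t * lrTest P Q t c y) -
      ((Q.rnDeriv P y).toReal * φ y - t * φ y)) ∂P := by
    refine integral_nonneg fun y => ?_
    have hy := hφ.mem y
    simp only [Pi.zero_apply, lrTest]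
    split_ifs with h h'
    · nlinarith
    · rw [h']; linarith
    · have : (Q.rnDeriv P y).toReal ≤ t := not_lt.1 h
      nlinarith
  have hsub : Integrable (fun y => (Q.rnDeriv P y).toReal * lrTest P Q t c y -
      t * lrTest P Q t c y) P := (key hL).2.sub ((hL.integrable P).const_mul t)
  have hsub' : Integrable (fun y => (Q.rnDeriv P y).toReal * φ y - t * φ y) P :=
    (key hφ).2.sub ((hφ.integrable P).const_mul t)
  rw [integral_sub hsub hsub', integral_sub (key hL).2 ((hL.integrable P).const_mul t),
    integral_sub (key hφ).2 ((hφ.integrable P).const_mul t)] at h1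
  linarith

/-- In the Lagrangian inequality the multiplier `t` is nonnegative, so a competitor with no larger
type I error cannot have smaller type II error. -/
lemma tradeOff_lrTypeI [IsProbabilityMeasure P] [IsProbabilityMeasure Q] (hQ : Q ≪ P)
    (ht : 0 ≤ t) (hc : c ∈ Set.Icc (0 : ℝ) 1) :
    tradeOff P Q (lrTypeI P Q t c) = ∫ y, (1 - lrTest P Q t c y) ∂Q := by
  refine le_antisymm (tradeOff_le (isTest_lrTest hc) integral_lrTest.le)
    (le_tradeOff (lrTypeI_mem_Icc hc).1 fun φ hφ h => ?_)
  have := integral_lrTest_add_le (t := t) hQ hc hφ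
  nlinarith

/-- The trade-off function of a mixture with observed index, at the type I errors of likelihood
ratio tests with a common threshold. -/
lemma tradeOff_mixture_lrTypeI {ι : Type*} [Fintype ι] [MeasurableSpace ι]
    [DiscreteMeasurableSpace ι] {w : ι → ℝ} (hw : ∀ i, 0 ≤ w i) {P Q : ι → Measure Y}
    [∀ i, IsProbabilityMeasure (P i)] [∀ i, IsProbabilityMeasure (Q i)] (hQ : ∀ i, Q i ≪ P i)
    (ht : 0 ≤ t) (hc : c ∈ Set.Icc (0 : ℝ) 1) :
    tradeOff (mixture w P) (mixture w Q) (∑ i, w i * lrTypeI (P i) (Q i) t c) =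
      ∑ i, w i * tradeOff (P i) (Q i) (lrTypeI (P i) (Q i) t c) := by
  refine le_antisymm (tradeOff_mixture_le hw P Q (fun i => (lrTypeI_mem_Icc hc).1) le_rfl)
    (le_tradeOff (Finset.sum_nonneg fun i _ => mul_nonneg (hw i) (lrTypeI_mem_Icc hc).1)
      fun φ hφ h => ?_)
  rw [integral_mixture hw _ hφ] at h
  rw [integral_mixture hw _ hφ.one_sub]
  -- Because the multiplier `t` is the same in every component, the summed inequalities involve only
  -- the total type I error.
  have := Finset.sum_le_sum fun i (_ : i ∈ Finset.univ) => mul_le_mul_of_nonneg_left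
    (integral_lrTest_add_le (t := t) (hQ i) hc (hφ.comp (measurable_prodMk_left (x := i)))) (hw i)
  simp only [mul_add, Finset.sum_add_distrib, mul_left_comm _ t, ← Finset.mul_sum] at this
  simp only [tradeOff_lrTypeI (hQ _) ht hc]
  nlinarith

open Set in
/-- Randomized upper tail probabilities of a law on `[0, M]` take every value in `[0, 1]`. -/
lemma exists_measureReal_Ioi_add_eq (ν : Measure ℝ) [IsProbabilityMeasure ν] {M : ℝ}
    (h0 : ν (Iio 0) = 0) (hM : ν (Ioi M) = 0) {α : ℝ} (hα : α ∈ Icc (0 : ℝ) 1) :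
    ∃ t c : ℝ, 0 ≤ t ∧ c ∈ Icc (0 : ℝ) 1 ∧ ν.real (Ioi t) + c * ν.real {t} = α := by
  have hIoi (t : ℝ) : ν.real (Ioi t) = 1 - cdf ν t := by
    rw [cdf_eq_real, ← compl_Iic, probReal_compl_eq_one_sub measurableSet_Iic]
  have hIci (t : ℝ) : ν.real (Ici t) = ν.real (Ioi t) + ν.real {t} := by
    rw [← measureReal_union (by simp) (measurableSet_singleton t)]
    congr 1; ext x; simp [le_iff_lt_or_eq]
  -- Its infimum is the `(1 - α)`-quantile; `c` then takes the right fraction of a possible atom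
  -- there. The bound `M` keeps `S` nonempty even for `α = 0`.
  set S : Set ℝ := {t | 0 ≤ t ∧ 1 - α ≤ cdf ν t}
  have hSne : S.Nonempty := by
    refine ⟨max M 0, le_max_right _ _, ?_⟩
    have : ν.real (Ioi (max M 0)) = 0 := by
      rw [measureReal_eq_zero_iff]
      exact measure_mono_null (Ioi_subset_Ioi (le_max_left _ _)) hM
    rw [hIoi] at this; linarith [hα.1]
  have hSbd : BddBelow S := ⟨0, fun t ht => ht.1⟩
  set t := sInf S with ht
  have ht0 : 0 ≤ t := le_csInf hSne fun t ht => ht.1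
  have hmem : 1 - α ≤ cdf ν t := by
    rw [← (cdf ν).iInf_Ioi_eq t]
    have : Nonempty (Ioi t) := ⟨⟨t + 1, by simp⟩⟩
    refine le_ciInf fun r => ?_
    obtain ⟨s, hs, hsr⟩ := exists_lt_of_csInf_lt hSne (show sInf S < r from r.2)
    exact hs.2.trans ((cdf ν).mono hsr.le)
  have hup : α ≤ ν.real (Ici t) := by
    rcases ht0.eq_or_lt with h | h
    · rw [← h, ← compl_Iio, probReal_compl_eq_one_sub measurableSet_Iio, measureReal_def, h0]
      simpa using hα.2
    · have : ν.real {t} = cdf ν t - Function.leftLim (cdf ν) t := by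
        conv_lhs => rw [← measure_cdf ν]
        rw [measureReal_def, StieltjesFunction.measure_singleton, ENNReal.toReal_ofReal]
        exact sub_nonneg.2 ((cdf ν).mono.leftLim_le le_rfl)
      have h' : Function.leftLim (cdf ν) t ≤ 1 - α := by
        refine le_of_tendsto ((cdf ν).mono.tendsto_leftLim t) ?_
        filter_upwards [Ioo_mem_nhdsLT h] with s hs
        by_contra! hlt
        exact absurd (csInf_le hSbd (show s ∈ S from ⟨hs.1.le, hlt.le⟩)) (not_le.2 hs.2)
      rw [hIci, hIoi, this]; linarith
  rw [hIci] at hup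
  have hlow : ν.real (Ioi t) ≤ α := by rw [hIoi]; linarith
  rcases (measureReal_nonneg (μ := ν) (s := {t})).eq_or_lt with h | h
  · exact ⟨t, 0, ht0, by simp, by linarith⟩
  · refine ⟨t, (α - ν.real (Ioi t)) / ν.real {t}, ht0, ⟨?_, ?_⟩, ?_⟩
    · apply div_nonneg <;> linarith
    · rw [div_le_one h]; linarith
    · field_simp; ring

/-- The weighted type I error is a randomized upper tail of one law on the line, namely the mixture
of the laws of the likelihood ratios under the null hypotheses. -/
lemma exists_sum_lrTypeI_eq {ι : Type*} [Fintype ι] {w : ι → ℝ} (hw : ∀ i, 0 ≤ w i)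
    (hw1 : ∑ i, w i = 1) {P Q : ι → Measure Y} [∀ i, IsProbabilityMeasure (P i)] {M : ℝ}
    (hM : ∀ i, ∀ᵐ y ∂(P i), ((Q i).rnDeriv (P i) y).toReal ≤ M) {α : ℝ}
    (hα : α ∈ Set.Icc (0 : ℝ) 1) :
    ∃ t c : ℝ, 0 ≤ t ∧ c ∈ Set.Icc (0 : ℝ) 1 ∧ ∑ i, w i * lrTypeI (P i) (Q i) t c = α := by
  have hm (i : ι) := measurable_toReal_rnDeriv (P := P i) (Q := Q i)
  set R : ι → Measure ℝ := fun i => (P i).map fun y => ((Q i).rnDeriv (P i) y).toReal with hR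
  have hRp (i : ι) : IsProbabilityMeasure (R i) :=
    Measure.isProbabilityMeasure_map (hm i).aemeasurable
  have := isProbabilityMeasure_sum_ofReal_smul hw hw1 R
  set ν := ∑ i, ENNReal.ofReal (w i) • R i with hν
  have hν0 (s : Set ℝ) (hs : ∀ i, R i s = 0) : ν s = 0 := by simp [hν, hs]
  have hνr (s : Set ℝ) : ν.real s = ∑ i, w i * (R i).real s := by
    simp only [hν, measureReal_def, Measure.coe_finsetSum, Finset.sum_apply, Measure.smul_apply,
      smul_eq_mul]
    rw [ENNReal.toReal_sum fun i _ => ENNReal.mul_ne_top ENNReal.ofReal_ne_top (measure_ne_top _ _)]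
    simp [ENNReal.toReal_ofReal (hw _)]
  obtain ⟨t, c, ht, hc, h⟩ := exists_measureReal_Ioi_add_eq ν (M := M)
    (hν0 _ fun i => by
      rw [hR, Measure.map_apply (hm i) measurableSet_Iio]
      convert measure_empty (μ := P i)
      ext y; simp)
    (hν0 _ fun i => by
      rw [hR, Measure.map_apply (hm i) measurableSet_Ioi]
      simpa [ae_iff, Set.preimage] using hM i) hα
  refine ⟨t, c, ht, hc, ?_⟩
  rw [← h, hνr, hνr, Finset.mul_sum, ← Finset.sum_add_distrib]
  refine Finset.sum_congr rfl fun i _ => ?_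
  rw [lrTypeI, hR, measureReal_def, measureReal_def, measureReal_def, measureReal_def,
    Measure.map_apply (hm i) measurableSet_Ioi,
    Measure.map_apply (hm i) (measurableSet_singleton t)]
  simp only [Set.preimage, Set.mem_Ioi, Set.mem_singleton_iff]
  ring

end NeymanPearson

/-! ### Isotropic Gaussian laws: affine images, reduction to one dimension, densities. -/

section GaussianShift

open scoped RealInnerProductSpace

/-- The isotropic Gaussian law `N(v, s² I)`. -/
noncomputable def gaussianShift {E : Type*} [NormedAddCommGroup E] [InnerProductSpace ℝ E]
    [FiniteDimensional ℝ E] [MeasurableSpace E] [BorelSpace E] (v : E) (s : ℝ) : Measure E :=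
  (stdGaussian E).map fun x => v + s • x

section Space

variable {E : Type*} [NormedAddCommGroup E] [InnerProductSpace ℝ E] [FiniteDimensional ℝ E]
  [MeasurableSpace E] [BorelSpace E]

instance (v : E) (s : ℝ) : IsProbabilityMeasure (gaussianShift v s) :=
  Measure.isProbabilityMeasure_map (by fun_prop)

lemma charFun_gaussianShift (v : E) (s : ℝ) (t : E) :
    charFun (gaussianShift v s) t =
      Complex.exp (⟪v, t⟫ * Complex.I - s ^ 2 * ‖t‖ ^ 2 / 2) := by
  have : gaussianShift v s = ((stdGaussian E).map (s • ·)).map (v + ·) := by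
    rw [Measure.map_map (by fun_prop) (by fun_prop)]; rfl
  rw [this, charFun_map_const_add, charFun_map_smul, charFun_stdGaussian, ← Complex.exp_add,
    norm_smul]
  congr 1
  rw [← Complex.ofReal_pow, mul_pow, Real.norm_eq_abs, sq_abs]
  push_cast
  ring

lemma map_gaussianShift (m v : E) (s τ : ℝ) :
    (gaussianShift v τ).map (fun x => m + s • x) = gaussianShift (m + s • v) (s * τ) := by
  rw [gaussianShift, Measure.map_map (by fun_prop) (by fun_prop), gaussianShift]
  congr 1
  ext x
  simp [smul_add, mul_smul, add_assoc]

lemma map_gaussianShift_isometry (R : E ≃ₗᵢ[ℝ] E) (v : E) (s : ℝ) :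
    (gaussianShift v s).map R = gaussianShift (R v) s := by
  have h : Measurable R := R.continuous.measurable
  rw [gaussianShift, Measure.map_map h (by fun_prop), gaussianShift]
  nth_rw 2 [← stdGaussian_map R]
  rw [Measure.map_map (by fun_prop) h]
  congr 1
  ext x
  simp

/-- Testing `N(0, I)` against `N(μ u, I)` with `‖u‖ ≤ 1` is at least as hard as testing `N(0, 1)`
against `N(μ, 1)`. -/
lemma gaussianTradeOff_le_gaussianShift {u : E} (hu : ‖u‖ ≤ 1) (μ : ℝ) {α : ℝ} (hα : 0 ≤ α) :
    gaussianTradeOff μ α ≤ tradeOff (gaussianShift (0 : E) 1) (gaussianShift (μ • u) 1) α := by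
  set r := √(1 - ‖u‖ ^ 2) with hr
  have hr0 : 0 ≤ r := Real.sqrt_nonneg _
  have hr2 : r ^ 2 = 1 - ‖u‖ ^ 2 := Real.sq_sqrt (by nlinarith [norm_nonneg u])
  -- The map `z ↦ z - k⟪z, u⟫u` must give the standard Gaussian covariance `I - u uᵀ`, so that
  -- adding an independent `N(a, 1)` multiple of `u` yields exactly `N(a u, I)`. This needs `2k -
  -- k²‖u‖² = 1`; the root is written so that it makes sense for `u = 0`.
  set k := (1 + r)⁻¹ with hk
  have hk2 : 2 * k - k ^ 2 * ‖u‖ ^ 2 = 1 := by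
    have : ‖u‖ ^ 2 = 1 - r ^ 2 := by linarith
    rw [this, hk]; field_simp; ring
  set F : ℝ × E → E := fun p => p.1 • u + (p.2 - (k * ⟪p.2, u⟫) • u) with hF
  have hFm : Measurable F := by fun_prop
  have key (a : ℝ) : ((gaussianReal a 1).prod (stdGaussian E)).map F = gaussianShift (a • u) 1 := by
    have : F = (fun p : E × E => p.1 + p.2) ∘
        Prod.map (fun x : ℝ => x • u) (fun z : E => z - (k * ⟪z, u⟫) • u) := rfl
    rw [this, ← Measure.map_map (by fun_prop) (by fun_prop),
      ← Measure.map_prod_map _ _ (by fun_prop) (by fun_prop), ← Measure.conv]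
    have : IsFiniteMeasure ((gaussianReal a 1).map fun x : ℝ => x • u) := by infer_instance
    have : IsFiniteMeasure ((stdGaussian E).map fun z : E => z - (k * ⟪z, u⟫) • u) := by
      infer_instance
    refine Measure.ext_of_charFun ?_
    ext t
    have h1 : charFun ((gaussianReal a 1).map fun x : ℝ => x • u) t =
        charFun (gaussianReal a 1) ⟪u, t⟫ := by
      rw [charFun_apply, charFun_apply_real, integral_map (by fun_prop) (by fun_prop)]
      simp only [real_inner_smul_left]
      push_cast
      simp only [mul_comm]
    have h2 : charFun ((stdGaussian E).map fun z : E => z - (k * ⟪z, u⟫) • u) t =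
        charFun (stdGaussian E) (t - (k * ⟪u, t⟫) • u) := by
      rw [charFun_apply, charFun_apply, integral_map (by fun_prop) (by fun_prop)]
      congr 1; ext z; congr 3
      rw [inner_sub_left, inner_sub_right, real_inner_smul_left, real_inner_smul_right]
      ring
    rw [charFun_conv, h1, h2, charFun_gaussianReal, charFun_stdGaussian, charFun_gaussianShift,
      ← Complex.exp_add]
    have h3 : ‖t - (k * ⟪u, t⟫) • u‖ ^ 2 = ‖t‖ ^ 2 - ⟪u, t⟫ ^ 2 := by
      rw [norm_sub_sq_real, real_inner_smul_right, norm_smul, mul_pow, Real.norm_eq_abs, sq_abs,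
        real_inner_comm u t]
      linear_combination (-⟪u, t⟫ ^ 2) * hk2
    congr 1
    rw [← Complex.ofReal_pow ‖_‖, h3, real_inner_smul_left]
    push_cast
    ring
  refine (tradeOff_prod_le (stdGaussian E) hα).trans ((tradeOff_map_le hFm hα).trans_eq ?_)
  rw [key, key, zero_smul]

end Space

section Coordinates

variable {ι : Type*} [Fintype ι]

lemma map_pi_gaussianReal (m : ι → ℝ) (s : ℝ) (v : NNReal) (hv : (v : ℝ) = s ^ 2) :
    (Measure.pi fun i => gaussianReal (m i) v).map (WithLp.toLp 2) =
      gaussianShift (WithLp.toLp 2 m : EuclideanSpace ℝ ι) s := by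
  have : IsProbabilityMeasure ((Measure.pi fun i => gaussianReal (m i) v).map
      (WithLp.toLp 2 : (ι → ℝ) → EuclideanSpace ℝ ι)) :=
    Measure.isProbabilityMeasure_map (by fun_prop)
  refine Measure.ext_of_charFun (E := EuclideanSpace ℝ ι) ?_
  ext t
  rw [charFun_pi, charFun_gaussianShift]
  simp only [charFun_gaussianReal, ← Complex.exp_sum]
  congr 1
  rw [← Complex.ofReal_pow ‖_‖, EuclideanSpace.real_norm_sq_eq, PiLp.inner_apply,
    Finset.sum_sub_distrib]
  have : (v : ℂ) = s ^ 2 := by exact_mod_cast congrArg (fun x : ℝ => (x : ℂ)) hv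
  simp only [this, Complex.ofReal_sum, Finset.sum_mul, Finset.mul_sum, Finset.sum_div]
  congr 1 <;> refine Finset.sum_congr rfl fun i _ => ?_
  · simp
  · push_cast; ring

/-- The density of `N(v, s² I)`. -/
noncomputable def gaussianDensity (s : ℝ) (x : EuclideanSpace ℝ ι) : ℝ :=
  (√(2 * Real.pi * s ^ 2))⁻¹ ^ Fintype.card ι * Real.exp (-‖x‖ ^ 2 / (2 * s ^ 2))

lemma gaussianDensity_pos {s : ℝ} (hs : s ≠ 0) (x : EuclideanSpace ℝ ι) :
    0 < gaussianDensity s x := by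
  have := Real.pi_pos
  unfold gaussianDensity; positivity

@[fun_prop]
lemma continuous_gaussianDensity (s : ℝ) :
    Continuous (gaussianDensity s : EuclideanSpace ℝ ι → ℝ) := by
  unfold gaussianDensity; fun_prop

lemma gaussianDensity_neg (s : ℝ) (x : EuclideanSpace ℝ ι) :
    gaussianDensity s (-x) = gaussianDensity s x := by simp [gaussianDensity]

lemma gaussianDensity_le {s : ℝ} {x y : EuclideanSpace ℝ ι} (h : ‖x‖ ≤ ‖y‖) :
    gaussianDensity s y ≤ gaussianDensity s x := by
  unfold gaussianDensity
  gcongr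

lemma pi_gaussianReal_eq_withDensity (m : ι → ℝ) {v : NNReal} (hv : v ≠ 0) :
    (Measure.pi fun i => gaussianReal (m i) v) =
      volume.withDensity fun x => ENNReal.ofReal (∏ i, gaussianPDFReal (m i) v (x i)) := by
  have hi : Integrable (fun x : ι → ℝ => ∏ i, gaussianPDFReal (m i) v (x i)) :=
    Integrable.fintype_prod fun i => integrable_gaussianPDFReal (m i) v
  refine (Measure.pi_eq fun s hs => ?_)
  rw [withDensity_apply _ (MeasurableSet.univ_pi hs), ← ofReal_integral_eq_lintegral_ofReal
    hi.restrict (ae_of_all _ fun x => Finset.prod_nonneg fun i _ => gaussianPDFReal_nonneg _ _ _),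
    volume_pi, Measure.restrict_pi_pi,
    integral_fintype_prod_eq_prod (fun i x => gaussianPDFReal (m i) v x),
    ENNReal.ofReal_prod_of_nonneg fun i _ => integral_nonneg fun x => gaussianPDFReal_nonneg _ _ _]
  simp only [gaussianReal_apply_eq_integral _ hv]

lemma measurable_ofReal_gaussianDensity (v : EuclideanSpace ℝ ι) (s : ℝ) :
    Measurable fun x => ENNReal.ofReal (gaussianDensity s (x - v)) := by fun_prop

lemma gaussianShift_eq_withDensity (v : EuclideanSpace ℝ ι) {s : ℝ} (hs : s ≠ 0) :
    gaussianShift v s =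
      volume.withDensity fun x => ENNReal.ofReal (gaussianDensity s (x - v)) := by
  have h : (((s ^ 2).toNNReal : NNReal) : ℝ) = s ^ 2 := Real.coe_toNNReal _ (sq_nonneg s)
  have h0 : (s ^ 2).toNNReal ≠ 0 := by
    rw [← NNReal.coe_ne_zero, h]; positivity
  have hv := map_pi_gaussianReal v.ofLp s _ h
  rw [WithLp.toLp_ofLp] at hv
  rw [← hv, pi_gaussianReal_eq_withDensity _ h0]
  have hmp := PiLp.volume_preserving_toLp ι
  have hd : (fun x : ι → ℝ => ENNReal.ofReal (∏ i, gaussianPDFReal (v i) (s ^ 2).toNNReal (x i))) =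
      (fun x => ENNReal.ofReal (gaussianDensity s (x - v))) ∘ WithLp.toLp 2 := by
    ext x
    simp only [gaussianPDFReal, h, Function.comp_apply, gaussianDensity, Finset.prod_mul_distrib,
      Finset.prod_const, Finset.card_univ, ← Real.exp_sum, EuclideanSpace.real_norm_sq_eq,
      PiLp.sub_apply, neg_div, Finset.sum_neg_distrib, Finset.sum_div]
  ext A hA
  rw [Measure.map_apply (by fun_prop) hA, withDensity_apply _ hA,
    withDensity_apply _ (WithLp.measurable_toLp 2 _ hA), hd]
  exact hmp.setLIntegral_comp_preimage hA (measurable_ofReal_gaussianDensity v s)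

lemma integral_gaussianShift (v : EuclideanSpace ℝ ι) {s : ℝ} (hs : s ≠ 0)
    (φ : EuclideanSpace ℝ ι → ℝ) :
    ∫ x, φ x ∂(gaussianShift v s) = ∫ x, gaussianDensity s (x - v) * φ x := by
  rw [gaussianShift_eq_withDensity v hs, integral_withDensity_eq_integral_toReal_smul
    (measurable_ofReal_gaussianDensity v s) (ae_of_all _ fun _ => ENNReal.ofReal_lt_top)]
  simp only [ENNReal.toReal_ofReal (gaussianDensity_pos hs _).le, smul_eq_mul]

lemma integrable_gaussianDensity_mul (v : EuclideanSpace ℝ ι) {s : ℝ} (hs : s ≠ 0)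
    {φ : EuclideanSpace ℝ ι → ℝ} (hφ : IsTest φ) :
    Integrable fun x => gaussianDensity s (x - v) * φ x := by
  have := hφ.integrable (gaussianShift v s)
  rw [gaussianShift_eq_withDensity v hs, integrable_withDensity_iff_integrable_smul'
    (measurable_ofReal_gaussianDensity v s) (ae_of_all _ fun _ => ENNReal.ofReal_lt_top)] at this
  simpa only [ENNReal.toReal_ofReal (gaussianDensity_pos hs _).le, smul_eq_mul] using this

end Coordinates

end GaussianShift

/-! ### Monotonicity of the trade-off in the size of the shift, for variance below one. -/

section GaussianMonotone

open scoped RealInnerProductSpace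

variable {ι : Type*} [Fintype ι]

/-- A test that decreases with the distance from a point on the far side of `m` has larger power
at `m + a u` than at `m - a u`. -/
lemma integral_gaussianShift_sub_le_add {s a b : ℝ} (hs : s ≠ 0) (ha : 0 ≤ a) (hb : 0 ≤ b)
    (m u : EuclideanSpace ℝ ι) {φ : EuclideanSpace ℝ ι → ℝ} (hφ : IsTest φ)
    (h : ∀ x y, ‖x - (m + b • u)‖ ≤ ‖y - (m + b • u)‖ → φ y ≤ φ x) :
    ∫ x, φ x ∂(gaussianShift (m - a • u) s) ≤ ∫ x, φ x ∂(gaussianShift (m + a • u) s) := by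
  set p : EuclideanSpace ℝ ι → ℝ := gaussianDensity s with hp
  have hpn (x) : p (-x) = p x := gaussianDensity_neg s x
  have hI (v : EuclideanSpace ℝ ι) : ∫ x, φ x ∂(gaussianShift (m + v) s) =
      ∫ x, p (x - v) * φ (m + x) := by
    rw [integral_gaussianShift _ hs, ← integral_add_left_eq_self _ m]
    simp only [add_sub_add_left_eq_sub, ← hp]
  have hI' (v : EuclideanSpace ℝ ι) : ∫ x, φ x ∂(gaussianShift (m + v) s) =
      ∫ x, p (x + v) * φ (m - x) := by
    rw [hI, ← integral_neg_eq_self]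
    congr 1; ext x
    rw [← hpn (x + v), neg_add, sub_eq_add_neg, sub_eq_add_neg]
  have hint (v : EuclideanSpace ℝ ι) : Integrable fun x => p (x - v) * φ (m + x) :=
    integrable_gaussianDensity_mul v hs (hφ.comp (by fun_prop))
  have hint' (v : EuclideanSpace ℝ ι) : Integrable fun x => p (x + v) * φ (m - x) := by
    simpa using integrable_gaussianDensity_mul (-v) hs (hφ.comp (g := fun x => m - x) (by fun_prop))
  -- Symmetrizing about `m`, twice the difference of powers is the integral of `(p (x - a u) - p (x
  -- + a u)) * (φ (m + x) - φ (m - x))`. Both factors have the sign of `⟪x, u⟫`.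
  have hdiff : 0 ≤ ∫ x, ((p (x - a • u) * φ (m + x) + p (x + a • u) * φ (m - x)) -
      (p (x - -(a • u)) * φ (m + x) + p (x + -(a • u)) * φ (m - x))) := by
    refine integral_nonneg fun x => ?_
    have hn1 : ‖x - a • u‖ ^ 2 + 4 * (a * ⟪x, u⟫) = ‖x + a • u‖ ^ 2 := by
      rw [norm_sub_sq_real, norm_add_sq_real, real_inner_smul_right]; ring
    have hn2 : ‖m + x - (m + b • u)‖ ^ 2 + 4 * (b * ⟪x, u⟫) = ‖m - x - (m + b • u)‖ ^ 2 := by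
      have e1 : m + x - (m + b • u) = x - b • u := by abel
      have e2 : m - x - (m + b • u) = -(x + b • u) := by abel
      rw [e1, e2, norm_neg, norm_sub_sq_real, norm_add_sq_real, real_inner_smul_right]; ring
    have hfac : 0 ≤ (p (x - a • u) - p (x + a • u)) * (φ (m + x) - φ (m - x)) := by
      rcases le_total 0 ⟪x, u⟫ with hx | hx
      · refine mul_nonneg (sub_nonneg.2 (gaussianDensity_le ?_)) (sub_nonneg.2 (h _ _ ?_))
        · refine le_of_sq_le_sq ?_ (norm_nonneg _)
          nlinarith [mul_nonneg ha hx]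
        · refine le_of_sq_le_sq ?_ (norm_nonneg _)
          nlinarith [mul_nonneg hb hx]
      · refine mul_nonneg_of_nonpos_of_nonpos (sub_nonpos.2 (gaussianDensity_le ?_))
          (sub_nonpos.2 (h _ _ ?_))
        · refine le_of_sq_le_sq ?_ (norm_nonneg _)
          nlinarith [mul_nonpos_of_nonneg_of_nonpos ha hx]
        · refine le_of_sq_le_sq ?_ (norm_nonneg _)
          nlinarith [mul_nonpos_of_nonneg_of_nonpos hb hx]
    simp only [Pi.zero_apply, sub_neg_eq_add, ← sub_eq_add_neg]
    linarith
  have hadd (v : EuclideanSpace ℝ ι) :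
      Integrable fun x => p (x - v) * φ (m + x) + p (x + v) * φ (m - x) := (hint v).add (hint' v)
  rw [integral_sub (hadd _) (hadd _), integral_add (hint _) (hint' _), integral_add (hint _) (hint' _), ← hI, ← hI, ← hI', ← hI',
    ← sub_eq_add_neg] at hdiff
  linarith

/-- The density of `N(v, τ² I)` with respect to `N(0, I)`. -/
noncomputable def gaussianLR (v : EuclideanSpace ℝ ι) (τ : ℝ) (x : EuclideanSpace ℝ ι) : ℝ :=
  gaussianDensity τ (x - v) / gaussianDensity 1 x

@[fun_prop]
lemma measurable_gaussianLR (v : EuclideanSpace ℝ ι) (τ : ℝ) : Measurable (gaussianLR v τ) := by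
  have : Continuous (gaussianDensity 1 : EuclideanSpace ℝ ι → ℝ) := continuous_gaussianDensity 1
  unfold gaussianLR
  exact Measurable.div (by fun_prop) this.measurable

lemma gaussianLR_nonneg (v : EuclideanSpace ℝ ι) {τ : ℝ} (hτ : τ ≠ 0) (x : EuclideanSpace ℝ ι) :
    0 ≤ gaussianLR v τ x :=
  div_nonneg (gaussianDensity_pos hτ _).le (gaussianDensity_pos one_ne_zero _).le

lemma withDensity_gaussianLR (v : EuclideanSpace ℝ ι) {τ : ℝ} (hτ : τ ≠ 0) :
    (gaussianShift 0 1).withDensity (fun x => ENNReal.ofReal (gaussianLR v τ x)) =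
      gaussianShift v τ := by
  rw [gaussianShift_eq_withDensity v hτ, gaussianShift_eq_withDensity 0 one_ne_zero,
    ← withDensity_mul _ (measurable_ofReal_gaussianDensity 0 1) (by fun_prop)]
  congr 1; ext x
  have := gaussianDensity_pos one_ne_zero x
  rw [Pi.mul_apply, ← ENNReal.ofReal_mul (gaussianDensity_pos one_ne_zero _).le, sub_zero,
    gaussianLR, mul_div_cancel₀ _ this.ne']

lemma gaussianShift_absolutelyContinuous (v : EuclideanSpace ℝ ι) {τ : ℝ} (hτ : τ ≠ 0) :
    gaussianShift v τ ≪ gaussianShift (0 : EuclideanSpace ℝ ι) 1 := by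
  rw [← withDensity_gaussianLR v hτ]; exact withDensity_absolutelyContinuous _ _

lemma toReal_rnDeriv_gaussianShift (v : EuclideanSpace ℝ ι) {τ : ℝ} (hτ : τ ≠ 0) :
    (fun x => ((gaussianShift v τ).rnDeriv (gaussianShift 0 1) x).toReal)
      =ᵐ[gaussianShift 0 1] gaussianLR v τ := by
  have := Measure.rnDeriv_withDensity (gaussianShift (0 : EuclideanSpace ℝ ι) 1)
    (f := fun x => ENNReal.ofReal (gaussianLR v τ x)) (by fun_prop)
  rw [withDensity_gaussianLR v hτ] at this
  filter_upwards [this] with x hx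
  rw [hx, ENNReal.toReal_ofReal (gaussianLR_nonneg v hτ x)]

/-- Completing the square: for `τ² < 1` the exponent is a concave quadratic centred at `v / (1 -
τ²)`, so the ratio is bounded and its superlevel sets are balls about that point. -/
lemma gaussianLR_eq (v x : EuclideanSpace ℝ ι) {τ : ℝ} (hτ : τ ≠ 0) (hτ1 : τ ^ 2 < 1) :
    gaussianLR v τ x = (√(2 * Real.pi * τ ^ 2))⁻¹ ^ Fintype.card ι /
      (√(2 * Real.pi * 1 ^ 2))⁻¹ ^ Fintype.card ι *
      Real.exp (-((1 - τ ^ 2) / (2 * τ ^ 2) * ‖x - (1 - τ ^ 2)⁻¹ • v‖ ^ 2) +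
        ‖v‖ ^ 2 / (2 * (1 - τ ^ 2))) := by
  rw [gaussianLR, gaussianDensity, gaussianDensity, mul_div_mul_comm, ← Real.exp_sub]
  congr 2
  have : 1 - τ ^ 2 ≠ 0 := by linarith
  rw [norm_sub_sq_real, norm_sub_sq_real, real_inner_smul_right, norm_smul, mul_pow,
    Real.norm_eq_abs, sq_abs]
  field_simp
  ring

lemma gaussianLR_antitone (v : EuclideanSpace ℝ ι) {τ : ℝ} (hτ : τ ≠ 0) (hτ1 : τ ^ 2 < 1)
    {x y : EuclideanSpace ℝ ι} (h : ‖x - (1 - τ ^ 2)⁻¹ • v‖ ≤ ‖y - (1 - τ ^ 2)⁻¹ • v‖) :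
    gaussianLR v τ y ≤ gaussianLR v τ x := by
  have : 0 < 1 - τ ^ 2 := by linarith
  rw [gaussianLR_eq v x hτ hτ1, gaussianLR_eq v y hτ hτ1]
  gcongr

lemma gaussianLR_le (v : EuclideanSpace ℝ ι) {τ : ℝ} (hτ : τ ≠ 0) (hτ1 : τ ^ 2 < 1)
    (x : EuclideanSpace ℝ ι) : gaussianLR v τ x ≤ gaussianLR v τ ((1 - τ ^ 2)⁻¹ • v) :=
  gaussianLR_antitone v hτ hτ1 (by simp)

/-- Testing against `N(r u, τ² I)` gets easier if `r` grows by a bounded factor. -/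
lemma tradeOff_gaussianShift_step {τ r r' : ℝ} (hτ : τ ≠ 0) (hτ1 : τ ^ 2 < 1) (hr' : r ≤ r')
    (hr : r' * (1 - τ ^ 2) ≤ r * (1 + τ ^ 2)) (u : EuclideanSpace ℝ ι) {α : ℝ}
    (hα : α ∈ Set.Icc (0 : ℝ) 1) :
    tradeOff (gaussianShift 0 1) (gaussianShift (r' • u) τ) α ≤
      tradeOff (gaussianShift 0 1) (gaussianShift (r • u) τ) α := by
  classical
  set P := gaussianShift (0 : EuclideanSpace ℝ ι) 1
  set Q := gaussianShift (r • u) τ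
  have hQ : Q ≪ P := gaussianShift_absolutelyContinuous _ hτ
  have hL : (fun x => (Q.rnDeriv P x).toReal) =ᵐ[P] gaussianLR (r • u) τ :=
    toReal_rnDeriv_gaussianShift (r • u) hτ
  obtain ⟨t, c, ht, hc, h⟩ := exists_sum_lrTypeI_eq (ι := Unit) (w := fun _ => 1)
    (fun _ => zero_le_one) (by simp) (P := fun _ => P) (Q := fun _ => Q)
    (M := gaussianLR (r • u) τ ((1 - τ ^ 2)⁻¹ • (r • u)))
    (fun _ => by filter_upwards [hL] with x hx; rw [hx]; exact gaussianLR_le _ hτ hτ1 x) hα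
  simp only [Finset.univ_unique, Finset.sum_singleton, one_mul] at h
  -- The Radon–Nikodym derivative is determined only almost everywhere, while the reflection
  -- argument needs a test that is monotone at every point; hence the explicit ratio.
  set φ : EuclideanSpace ℝ ι → ℝ := fun x =>
    if t < gaussianLR (r • u) τ x then 1 else if gaussianLR (r • u) τ x = t then c else 0 with hφd
  have hφL : lrTest P Q t c =ᵐ[P] φ := by
    filter_upwards [hL] with x hx
    simp only [lrTest, hφd, hx]
  have hφ : IsTest φ := by
    have hm := measurable_gaussianLR (r • u) τ
    refine ⟨Measurable.ite (measurableSet_lt measurable_const hm) measurable_const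
      (Measurable.ite (measurableSet_eq_fun hm measurable_const) measurable_const
        measurable_const), fun y => ?_⟩
    simp only [hφd]
    split_ifs <;> first | exact hc | norm_num
  have hφP : ∫ x, φ x ∂P = α := by rw [← h, ← integral_lrTest, integral_congr_ae hφL]
  have hφQ : ∫ x, (1 - φ x) ∂Q = tradeOff P Q α := by
    rw [← h, tradeOff_lrTypeI hQ ht hc]
    refine integral_congr_ae (hQ.ae_le ?_)
    filter_upwards [hφL] with x hx
    rw [hx]
  rw [← hφQ]
  refine (tradeOff_le hφ hφP.le).trans ?_
  rw [hφ.integral_one_sub, hφ.integral_one_sub]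
  have hpos : 0 < 1 - τ ^ 2 := by linarith
  -- Reflect about the midpoint of the two means. The centre `r / (1 - τ²)` of the rejection ball
  -- lies beyond that midpoint exactly when `r' (1 - τ²) ≤ r (1 + τ²)`, which is `hr`.
  have key := integral_gaussianShift_sub_le_add hτ (a := (r' - r) / 2)
    (b := r / (1 - τ ^ 2) - (r' + r) / 2) (by linarith)
    (by rw [sub_nonneg, div_le_div_iff₀ (by norm_num) hpos]; nlinarith)
    (((r' + r) / 2) • u) u hφ (fun x y hxy => ?_)
  · rw [← sub_smul, ← add_smul] at key
    have e1 : (r' + r) / 2 - (r' - r) / 2 = r := by ring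
    have e2 : (r' + r) / 2 + (r' - r) / 2 = r' := by ring
    rw [e1, e2] at key
    linarith
  · have e3 : ((r' + r) / 2) • u + (r / (1 - τ ^ 2) - (r' + r) / 2) • u =
        (1 - τ ^ 2)⁻¹ • (r • u) := by
      rw [← add_smul, smul_smul]; congr 1; ring
    rw [e3] at hxy
    have := gaussianLR_antitone (r • u) hτ hτ1 hxy
    simp only [hφd]
    have := hc.1
    have := hc.2
    split_ifs <;> first
      | linarith
      | exact absurd (le_antisymm (by linarith) (by linarith)) ‹¬gaussianLR (r • u) τ x = t›

/-- One step may enlarge `r` by any factor up to `k = (1 + τ²) / (1 - τ²) > 1`, so finitely many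
steps reach every `r'`. -/
lemma tradeOff_gaussianShift_antitone_of_pos {τ r r' : ℝ} (hτ : τ ≠ 0) (hτ1 : τ ^ 2 < 1)
    (hr : 0 < r) (hrr' : r ≤ r') (u : EuclideanSpace ℝ ι) {α : ℝ}
    (hα : α ∈ Set.Icc (0 : ℝ) 1) :
    tradeOff (gaussianShift 0 1) (gaussianShift (r' • u) τ) α ≤
      tradeOff (gaussianShift 0 1) (gaussianShift (r • u) τ) α := by
  have hpos : 0 < 1 - τ ^ 2 := by linarith
  have hτ2 : 0 < τ ^ 2 := by positivity
  set k := (1 + τ ^ 2) / (1 - τ ^ 2) with hk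
  have hk1 : 1 < k := by rw [hk, one_lt_div hpos]; linarith
  have key (n : ℕ) : ∀ s, r ≤ s → s ≤ k ^ n * r →
      tradeOff (gaussianShift 0 1) (gaussianShift (s • u) τ) α ≤
        tradeOff (gaussianShift 0 1) (gaussianShift (r • u) τ) α := by
    induction n with
    | zero => intro s h1 h2; rw [le_antisymm (by simpa using h2) h1]
    | succ n ih =>
      intro s h1 h2
      have hstep (s' : ℝ) (h1 : s' ≤ s) (h2 : s ≤ k * s') :
          tradeOff (gaussianShift 0 1) (gaussianShift (s • u) τ) α ≤
            tradeOff (gaussianShift 0 1) (gaussianShift (s' • u) τ) α := by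
        refine tradeOff_gaussianShift_step hτ hτ1 h1 ?_ u hα
        rw [hk, div_mul_eq_mul_div, le_div_iff₀ hpos] at h2
        linarith
      have hk0 : 0 < k := by linarith
      rcases le_total s (k * r) with h | h
      · exact hstep r h1 h
      · refine (hstep (s / k) (div_le_self (hr.le.trans h1) hk1.le)
          (by rw [mul_div_cancel₀ _ hk0.ne'])).trans (ih _ ?_ ?_)
        · rw [le_div_iff₀ hk0]; linarith
        · rw [div_le_iff₀ hk0]; rw [pow_succ] at h2; linarith
  obtain ⟨n, hn⟩ := pow_unbounded_of_one_lt (r' / r) hk1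
  exact key n r' hrr' (by rw [div_lt_iff₀ hr] at hn; exact hn.le)

lemma integrable_exp_neg_mul_norm_sq {b : ℝ} (hb : 0 < b) :
    Integrable fun x : EuclideanSpace ℝ ι => Real.exp (-b * ‖x‖ ^ 2) := by
  have := GaussianFourier.integrable_cexp_neg_mul_sq_norm_add
    (V := EuclideanSpace ℝ ι) (b := b) (by simpa using hb) 0 0
  convert this.norm using 1
  ext x
  simp [Complex.norm_exp, ← Complex.ofReal_pow]

/-- Multiplicative steps never leave `r = 0`; this continuity covers that endpoint. -/
lemma tendsto_integral_gaussianShift_smul {τ : ℝ} (hτ : τ ≠ 0) (u : EuclideanSpace ℝ ι)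
    {φ : EuclideanSpace ℝ ι → ℝ} (hφ : IsTest φ) :
    Filter.Tendsto (fun r : ℝ => ∫ x, φ x ∂(gaussianShift (r • u) τ)) (nhdsWithin 0 (Set.Ioi 0))
      (nhds (∫ x, φ x ∂(gaussianShift 0 τ))) := by
  simp only [integral_gaussianShift _ hτ]
  set A : ℝ := (√(2 * Real.pi * τ ^ 2))⁻¹ ^ Fintype.card ι with hA
  have hA0 : 0 ≤ A := by positivity
  refine tendsto_integral_filter_of_dominated_convergence
    (fun x => A * (Real.exp (‖u‖ ^ 2 / (2 * τ ^ 2)) * Real.exp (-(1 / (4 * τ ^ 2)) * ‖x‖ ^ 2)))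
    (Filter.Eventually.of_forall fun r =>
      (integrable_gaussianDensity_mul (r • u) hτ hφ).aestronglyMeasurable) ?_ ?_ ?_
  · filter_upwards [Ioo_mem_nhdsGT (zero_lt_one' ℝ)] with r hr
    refine ae_of_all _ fun x => ?_
    have hp := gaussianDensity_pos hτ (x - r • u)
    rw [Real.norm_of_nonneg (mul_nonneg hp.le (hφ.mem x).1)]
    refine (mul_le_of_le_one_right hp.le (hφ.mem x).2).trans ?_
    rw [gaussianDensity, ← Real.exp_add, ← hA]
    refine mul_le_mul_of_nonneg_left (Real.exp_le_exp.2 ?_) hA0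
    -- This bound, uniform in `0 < r < 1`, replaces the moving Gaussian by a fixed one of twice the
    -- variance, at the cost of a constant factor.
    have h1 : ‖x‖ ^ 2 ≤ 2 * ‖x - r • u‖ ^ 2 + 2 * ‖u‖ ^ 2 := by
      have h2 : ‖x‖ ≤ ‖x - r • u‖ + ‖r • u‖ := by
        simpa using norm_add_le (x - r • u) (r • u)
      have h3 : ‖r • u‖ ≤ ‖u‖ := by
        rw [norm_smul, Real.norm_of_nonneg hr.1.le]
        exact mul_le_of_le_one_left (norm_nonneg _) hr.2.le
      nlinarith [norm_nonneg x, norm_nonneg u, norm_nonneg (x - r • u),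
        sq_nonneg (‖x - r • u‖ - ‖u‖)]
    have : ‖u‖ ^ 2 / (2 * τ ^ 2) + -(1 / (4 * τ ^ 2)) * ‖x‖ ^ 2 - -‖x - r • u‖ ^ 2 / (2 * τ ^ 2) =
        (2 * ‖x - r • u‖ ^ 2 + 2 * ‖u‖ ^ 2 - ‖x‖ ^ 2) / (4 * τ ^ 2) := by
      field_simp; ring
    have h4 : 0 ≤ (2 * ‖x - r • u‖ ^ 2 + 2 * ‖u‖ ^ 2 - ‖x‖ ^ 2) / (4 * τ ^ 2) :=
      div_nonneg (by linarith) (by positivity)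
    linarith
  · refine ((Integrable.const_mul ?_ _).const_mul _)
    exact integrable_exp_neg_mul_norm_sq (by positivity)
  · refine ae_of_all _ fun x => Filter.Tendsto.mul_const _ ?_
    have : Continuous fun r : ℝ => gaussianDensity τ (x - r • u) := by fun_prop
    simpa using (this.tendsto 0).mono_left nhdsWithin_le_nhds

lemma tradeOff_gaussianShift_antitone {τ r r' : ℝ} (hτ : τ ≠ 0) (hτ1 : τ ^ 2 < 1)
    (hr : 0 ≤ r) (hrr' : r ≤ r') (u : EuclideanSpace ℝ ι) {α : ℝ}
    (hα : α ∈ Set.Icc (0 : ℝ) 1) :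
    tradeOff (gaussianShift 0 1) (gaussianShift (r' • u) τ) α ≤
      tradeOff (gaussianShift 0 1) (gaussianShift (r • u) τ) α := by
  rcases hr.eq_or_lt with rfl | hr
  · rcases hrr'.eq_or_lt with rfl | hr'
    · exact le_rfl
    rw [zero_smul]
    refine le_tradeOff hα.1 fun φ hφ h => ?_
    refine ge_of_tendsto (tendsto_integral_gaussianShift_smul hτ u hφ.one_sub) ?_
    filter_upwards [Ioo_mem_nhdsGT hr'] with s hs
    exact (tradeOff_gaussianShift_antitone_of_pos hτ hτ1 hs.1 hs.2.le u hα).trans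
      (tradeOff_le hφ h)
  · exact tradeOff_gaussianShift_antitone_of_pos hτ hτ1 hr hrr' u hα

/-- For `τ < 1`, testing `N(0, I)` against `N(v, τ² I)` is at least as hard as against
`N(r e, τ² I)` for any unit vector `e` and `‖v‖ ≤ r`. -/
lemma tradeOff_gaussianShift_le_of_norm_le {τ r : ℝ} (hτ : τ ≠ 0) (hτ1 : τ ^ 2 < 1)
    {v e : EuclideanSpace ℝ ι} (he : ‖e‖ = 1) (hv : ‖v‖ ≤ r) {α : ℝ}
    (hα : α ∈ Set.Icc (0 : ℝ) 1) :
    tradeOff (gaussianShift 0 1) (gaussianShift (r • e) τ) α ≤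
      tradeOff (gaussianShift 0 1) (gaussianShift v τ) α := by
  refine (tradeOff_gaussianShift_antitone hτ hτ1 (norm_nonneg v) hv e hα).trans ?_
  have hn : ‖‖v‖ • e‖ = ‖v‖ := by rw [norm_smul, he, norm_norm, mul_one]
  -- This reflection takes `‖v‖ e` to `v`, the two having equal norm, and preserves `N(0, I)`.
  set R := (ℝ ∙ (‖v‖ • e - v))ᗮ.reflection with hR
  refine (tradeOff_map_le R.continuous.measurable hα.1).trans_eq ?_
  rw [map_gaussianShift_isometry, map_gaussianShift_isometry, map_zero, hR,
    Submodule.reflection_sub hn]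

end GaussianMonotone

/-! ### Rescaled Gaussian comparisons and the trade-off of a subsampled pair. -/

section Comparison

variable {n : ℕ}

lemma gaussianTradeOff_le_of_norm_sub_le {v v' : EuclideanSpace ℝ (Fin n)} {s r : ℝ} (hs : 0 < s)
    (hr : 0 < r) (h : ‖v' - v‖ ≤ s * r) {α : ℝ} (hα : 0 ≤ α) :
    gaussianTradeOff r α ≤ tradeOff (gaussianShift v s) (gaussianShift v' s) α := by
  have hu : ‖(s * r)⁻¹ • (v' - v)‖ ≤ 1 := by
    rw [norm_smul, norm_inv, Real.norm_of_nonneg (by positivity), inv_mul_le_iff₀ (by positivity)]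
    linarith
  refine (gaussianTradeOff_le_gaussianShift hu r hα).trans
    ((tradeOff_map_le (F := fun x => v + s • x) (by fun_prop) hα).trans_eq ?_)
  rw [map_gaussianShift, map_gaussianShift, smul_smul, smul_smul]
  have : s * (r * (s * r)⁻¹) = 1 := by field_simp
  simp [← mul_assoc] at this ⊢
  simp [this]

lemma tradeOff_gaussianShift_le_of_norm_sub_le {v v' e : EuclideanSpace ℝ (Fin n)} {s r τ : ℝ}
    (he : ‖e‖ = 1) (hs : 0 < s) (hτ : τ ≠ 0) (hτ1 : τ ^ 2 < 1) (h : ‖v' - v‖ ≤ s * r) {α : ℝ}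
    (hα : α ∈ Set.Icc (0 : ℝ) 1) :
    tradeOff (gaussianShift 0 1) (gaussianShift (r • e) τ) α ≤
      tradeOff (gaussianShift v s) (gaussianShift v' (s * τ)) α := by
  have hu : ‖s⁻¹ • (v' - v)‖ ≤ r := by
    rw [norm_smul, norm_inv, Real.norm_of_nonneg hs.le, inv_mul_le_iff₀ hs]
    exact h
  refine (tradeOff_gaussianShift_le_of_norm_le hτ hτ1 he hu hα).trans
    ((tradeOff_map_le (F := fun x => v + s • x) (by fun_prop) hα.1).trans_eq ?_)
  rw [map_gaussianShift, map_gaussianShift, smul_smul, mul_inv_cancel₀ hs.ne']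
  simp

/-- Exhibits the subsampled bound as a genuine trade-off function. The upper bound needs
near-optimal tests of type I error exactly `α`, since the `P` part of the alternative contributes
one minus that error. -/
lemma tradeOff_sum_self {Y : Type*} [MeasurableSpace Y] {P Q : Measure Y} [IsProbabilityMeasure P]
    [IsProbabilityMeasure Q] {q : ℝ} (hq0 : 0 ≤ q) (hq1 : q ≤ 1) {α : ℝ}
    (hα : α ∈ Set.Icc (0 : ℝ) 1) :
    tradeOff P (∑ b : Bool, ENNReal.ofReal (cond b q (1 - q)) • cond b Q P) α =
      q * tradeOff P Q α + (1 - q) * (1 - α) := by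
  have hw (b : Bool) : 0 ≤ cond b q (1 - q) := by cases b <;> simp <;> linarith
  have (b : Bool) : IsProbabilityMeasure (cond b Q P) := by cases b <;> assumption
  have key {φ : Y → ℝ} (hφ : IsTest φ) :
      ∫ y, (1 - φ y) ∂(∑ b : Bool, ENNReal.ofReal (cond b q (1 - q)) • cond b Q P) =
        q * ∫ y, (1 - φ y) ∂Q + (1 - q) * (1 - ∫ y, φ y ∂P) := by
    rw [integral_sum_ofReal_smul hw _ hφ.one_sub, ← hφ.integral_one_sub]
    simp
  refine le_antisymm (le_of_forall_pos_le_add fun ε hε => ?_) (le_tradeOff hα.1 fun φ hφ h => ?_)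
  · obtain ⟨φ, hφ, h1, h2⟩ := exists_test_lt_of_eq (P := P) (Q := Q) hα hε
    refine (tradeOff_le hφ h1.le).trans ?_
    rw [key hφ, h1]
    nlinarith
  · rw [key hφ]
    have := tradeOff_le (Q := Q) hφ h
    have := mul_le_mul_of_nonneg_left this hq0
    have := mul_le_mul_of_nonneg_left h (sub_nonneg.2 hq1)
    linarith

end Comparison

/-! ### The mechanism as a Gaussian mixture over batches; equal normalization factors. -/

section Mechanism

variable {X : Type*} {n N : ℕ} {q C σ : ℝ}

lemma norm_clip_le (hC : 0 < C) (v : EuclideanSpace ℝ (Fin n)) : ‖clip C v‖ ≤ C := by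
  have h : 0 < max 1 (‖v‖ / C) := lt_max_of_lt_left one_pos
  rw [clip, norm_smul, norm_inv, Real.norm_of_nonneg h.le, inv_mul_le_iff₀ h]
  have := le_max_right 1 (‖v‖ / C)
  rw [div_le_iff₀ hC] at this
  exact this

lemma norm_sum_clip_le (hC : 0 < C) {ι : Type*} (B : Finset ι)
    (v : ι → EuclideanSpace ℝ (Fin n)) : ‖∑ i ∈ B, clip C (v i)‖ ≤ B.card * C := by
  simpa using norm_sum_le_of_le B fun i _ => norm_clip_le hC (v i)

lemma batchProb_nonneg (hq0 : 0 ≤ q) (hq1 : q ≤ 1) (B : Finset (Fin N)) : 0 ≤ batchProb q B :=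
  mul_nonneg (pow_nonneg hq0 _) (pow_nonneg (sub_nonneg.2 hq1) _)

lemma sum_batchProb (q : ℝ) (N : ℕ) : ∑ B : Finset (Fin N), batchProb q B = 1 := by
  have := Fin.sum_pow_mul_eq_add_pow (n := N) q (1 - q)
  simpa [batchProb] using this

lemma gaussianNoise_eq_gaussianShift (n : ℕ) (s : ℝ) : gaussianNoise n s = gaussianShift 0 s := by
  have := map_pi_gaussianReal (fun _ : Fin n => 0) s _ (Real.coe_toNNReal _ (sq_nonneg s))
  rwa [show (WithLp.toLp 2 fun _ : Fin n => (0 : ℝ)) = 0 from rfl] at this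

lemma integral_feasgm (hq0 : 0 ≤ q) (hq1 : q ≤ 1) (g : X → EuclideanSpace ℝ (Fin n))
    (D : Fin N → X) {φ : EuclideanSpace ℝ (Fin n) → ℝ} (hφ : IsTest φ) :
    ∫ y, φ y ∂(feasgm q C σ g N D) = ∑ B : Finset (Fin N), batchProb q B *
      ∫ y, φ y ∂(gaussianShift ((floorFactor q N)⁻¹ • ∑ i ∈ B, clip C (g (D i)))
        ((floorFactor q N)⁻¹ * (σ * C))) := by
  have h (B : Finset (Fin N)) : (gaussianNoise n (σ * C)).map
      (fun G => (floorFactor q N)⁻¹ • ((∑ i ∈ B, clip C (g (D i))) + G)) =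
      gaussianShift ((floorFactor q N)⁻¹ • ∑ i ∈ B, clip C (g (D i)))
        ((floorFactor q N)⁻¹ * (σ * C)) := by
    simp only [smul_add]
    rw [gaussianNoise_eq_gaussianShift, map_gaussianShift, smul_zero, add_zero]
  simp only [feasgm, h]
  exact integral_sum_ofReal_smul (batchProb_nonneg hq0 hq1) _ hφ

lemma sum_finset_fin_succ {M : Type*} [AddCommMonoid M] (f : Finset (Fin (N + 1)) → M) :
    ∑ B, f B = ∑ B : Finset (Fin N), (f (B.map Fin.castSuccEmb) +
      f (insert (Fin.last N) (B.map Fin.castSuccEmb))) := by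
  classical
  have hp : ((Finset.univ : Finset (Fin N)).map Fin.castSuccEmb).powerset =
      Finset.univ.map (Finset.mapEmbedding Fin.castSuccEmb).toEmbedding := by
    ext A
    simp only [Finset.mem_powerset, Finset.subset_map_iff, Finset.mem_map, Finset.mem_univ,
      true_and, Finset.subset_univ]
    exact ⟨fun ⟨B, h⟩ => ⟨B, h.symm⟩, fun ⟨B, h⟩ => ⟨B, h.symm⟩⟩
  have hl : Fin.last N ∉ (Finset.univ : Finset (Fin N)).map Fin.castSuccEmb := by simp
  rw [← Finset.powerset_univ, Fin.univ_castSuccEmb, Finset.cons_eq_insert,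
    Finset.sum_powerset_insert hl, hp, Finset.sum_map, Finset.sum_map, Finset.sum_add_distrib]
  rfl

lemma batchProb_map_castSucc (q : ℝ) (B : Finset (Fin N)) :
    batchProb q (B.map Fin.castSuccEmb) = batchProb q B * (1 - q) := by
  have : B.card ≤ N := by simpa using B.card_le_univ
  rw [batchProb, batchProb, Finset.card_map, Nat.succ_sub this, pow_succ, mul_assoc]

lemma batchProb_insert_last (q : ℝ) (B : Finset (Fin N)) :
    batchProb q (insert (Fin.last N) (B.map Fin.castSuccEmb)) = batchProb q B * q := by
  rw [batchProb, batchProb, Finset.card_insert_of_notMem (by simp), Finset.card_map,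
    Nat.add_sub_add_right, pow_succ]
  ring

lemma integral_feasgm_snoc (hq0 : 0 ≤ q) (hq1 : q ≤ 1) (g : X → EuclideanSpace ℝ (Fin n))
    (D : Fin N → X) (d : X) {φ : EuclideanSpace ℝ (Fin n) → ℝ} (hφ : IsTest φ) :
    ∫ y, φ y ∂(feasgm q C σ g (N + 1) (Fin.snoc D d)) = ∑ B : Finset (Fin N), batchProb q B *
      ((1 - q) * ∫ y, φ y ∂(gaussianShift
          ((floorFactor q (N + 1))⁻¹ • ∑ i ∈ B, clip C (g (D i)))
          ((floorFactor q (N + 1))⁻¹ * (σ * C))) +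
        q * ∫ y, φ y ∂(gaussianShift
          ((floorFactor q (N + 1))⁻¹ • (∑ i ∈ B, clip C (g (D i)) + clip C (g d)))
          ((floorFactor q (N + 1))⁻¹ * (σ * C)))) := by
  rw [integral_feasgm hq0 hq1 g _ hφ, sum_finset_fin_succ]
  refine Finset.sum_congr rfl fun B _ => ?_
  rw [batchProb_map_castSucc, batchProb_insert_last, Finset.sum_insert (by simp), Finset.sum_map]
  simp only [Fin.castSuccEmb_apply, Fin.snoc_castSucc, Fin.snoc_last]
  rw [add_comm (clip C (g d))]
  ring

lemma floorFactor_pos (q : ℝ) (N : ℕ) : 0 < floorFactor q N := by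
  unfold floorFactor
  exact_mod_cast lt_max_of_lt_right one_pos

/-- The guarantee of the subsampled Gaussian mechanism holds if the normalization factors of the
two dataset sizes agree. -/
lemma isPrivacyGuarantee_feasgm_of_floor_eq (hq0 : 0 ≤ q) (hq1 : q ≤ 1) (hC : 0 < C) (hσ : 0 < σ)
    (g : X → EuclideanSpace ℝ (Fin n)) (hF : floorFactor q (N + 1) = floorFactor q N) :
    IsPrivacyGuarantee (feasgm q C σ g) N
      (fun α => q * gaussianTradeOff (1 / σ) α + (1 - q) * idTradeOff α) := by
  have hb (b : Bool) : IsProbabilityMeasure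
      (cond b (gaussianReal (1 / σ) 1) (gaussianReal 0 1)) := by
    cases b <;> simp only [cond_true, cond_false] <;> infer_instance
  refine ⟨⟨ℝ, inferInstance, gaussianReal 0 1, _, inferInstance,
    isProbabilityMeasure_sum_ofReal_smul (w := fun b => cond b q (1 - q)) (fun b => ?_) (by simp)
      (fun b => cond b (gaussianReal (1 / σ) 1) (gaussianReal 0 1)), fun α hα =>
      (tradeOff_sum_self hq0 hq1 hα).symm⟩, fun D d α hα => ?_⟩
  · cases b <;> simp <;> linarith
  refine le_tradeOff hα.1 fun φ hφ h => ?_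
  rw [integral_feasgm hq0 hq1 g D hφ] at h
  rw [integral_feasgm_snoc hq0 hq1 g D d hφ.one_sub, hF]
  set F := floorFactor q N with hFd
  have hFpos : 0 < F := floorFactor_pos q N
  set m : Finset (Fin N) → EuclideanSpace ℝ (Fin n) := fun B => ∑ i ∈ B, clip C (g (D i))
  set a : Finset (Fin N) → ℝ := fun B => ∫ y, φ y ∂(gaussianShift (F⁻¹ • m B) (F⁻¹ * (σ * C)))
    with ha
  have ha0 (B) : 0 ≤ a B := hφ.integral_nonneg _
  have hP := batchProb_nonneg (N := N) hq0 hq1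
  have hG (B : Finset (Fin N)) : gaussianTradeOff (1 / σ) (a B) ≤
      ∫ y, (1 - φ y) ∂(gaussianShift (F⁻¹ • (m B + clip C (g d))) (F⁻¹ * (σ * C))) := by
    refine (gaussianTradeOff_le_of_norm_sub_le (v := F⁻¹ • m B)
      (v' := F⁻¹ • (m B + clip C (g d))) (s := F⁻¹ * (σ * C)) (by positivity) (by positivity)
      ?_ (ha0 B)).trans (tradeOff_le hφ le_rfl)
    rw [← smul_sub, add_sub_cancel_left, norm_smul, Real.norm_of_nonneg (by positivity), mul_assoc]
    gcongr
    have : σ * C * (1 / σ) = C := by field_simp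
    rw [this]
    exact norm_clip_le hC _
  -- Jensen: the type I errors `a B` vary with the batch, and their average is at most `α`.
  have hconv : gaussianTradeOff (1 / σ) α ≤
      ∑ B : Finset (Fin N), batchProb q B * gaussianTradeOff (1 / σ) (a B) := by
    let _ : MeasurableSpace (Finset (Fin N)) := ⊤
    exact (tradeOff_antitone (Finset.sum_nonneg fun B _ => mul_nonneg (hP B) (ha0 B)) h).trans
      (tradeOff_sum_le hP (sum_batchProb q N) _ _ ha0)
  calc q * gaussianTradeOff (1 / σ) α + (1 - q) * idTradeOff α
      ≤ q * ∑ B : Finset (Fin N), batchProb q B * gaussianTradeOff (1 / σ) (a B) +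
        (1 - q) * (1 - ∑ B : Finset (Fin N), batchProb q B * a B) := by
        unfold idTradeOff
        gcongr
    _ = ∑ B : Finset (Fin N), batchProb q B *
        ((1 - q) * (1 - a B) + q * gaussianTradeOff (1 / σ) (a B)) := by
        have hs : 1 - ∑ B : Finset (Fin N), batchProb q B * a B =
            ∑ B : Finset (Fin N), batchProb q B * (1 - a B) := by
          simp only [mul_sub, mul_one, Finset.sum_sub_distrib, sum_batchProb]
        rw [hs, Finset.mul_sum, Finset.mul_sum, ← Finset.sum_add_distrib]
        exact Finset.sum_congr rfl fun B _ => by ring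
    _ ≤ _ := by
        refine Finset.sum_le_sum fun B _ => mul_le_mul_of_nonneg_left ?_ (hP B)
        rw [hφ.integral_one_sub (gaussianShift (F⁻¹ • m B) (F⁻¹ * (σ * C)))]
        gcongr
        exact hG B

end Mechanism

/-! ### The product laws as Euclidean Gaussians; the degenerate case `K = 0`. -/

section ShiftProd

variable {n : ℕ}

instance (n : ℕ) : IsProbabilityMeasure (stdProd n) := by unfold stdProd; infer_instance

instance (n K : ℕ) (μ : ℝ) : IsProbabilityMeasure (shiftProd n K μ) := by
  unfold shiftProd; infer_instance

lemma map_toLp_stdProd (n : ℕ) :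
    (stdProd n).map (MeasurableEquiv.toLp 2 (Fin n → ℝ)) = gaussianShift 0 1 := by
  have := map_pi_gaussianReal (fun _ : Fin n => 0) 1 1 (by simp)
  rwa [show (WithLp.toLp 2 fun _ : Fin n => (0 : ℝ)) = 0 from rfl] at this

lemma map_toLp_shiftProd (hn : 1 ≤ n) (K : ℕ) (μ : ℝ) :
    (shiftProd n K μ).map (MeasurableEquiv.toLp 2 (Fin n → ℝ)) =
      gaussianShift (μ • EuclideanSpace.single ⟨n - 1, by omega⟩ 1) (K / (K + 1) : ℝ) := by
  have := map_pi_gaussianReal (fun i : Fin n => if (i : ℕ) + 1 = n then μ else 0)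
    (K / (K + 1) : ℝ) (((K : NNReal) / ((K : NNReal) + 1)) ^ 2) (by push_cast; rfl)
  rw [MeasurableEquiv.coe_toLp, shiftProd, this]
  congr 1
  ext i
  simp only [PiLp.smul_apply, PiLp.single_apply, smul_eq_mul, Fin.ext_iff]
  have : (i : ℕ) + 1 = n ↔ (i : ℕ) = n - 1 := by omega
  simp [this]

lemma tradeOff_stdProd_shiftProd (hn : 1 ≤ n) (K : ℕ) (μ : ℝ) {α : ℝ} (hα : 0 ≤ α) :
    tradeOff (stdProd n) (shiftProd n K μ) α =
      tradeOff (gaussianShift 0 1)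
        (gaussianShift (μ • EuclideanSpace.single (⟨n - 1, by omega⟩ : Fin n) (1 : ℝ))
          (K / (K + 1) : ℝ)) α := by
  rw [← map_toLp_stdProd, ← map_toLp_shiftProd hn, tradeOff_map_equiv _ hα]

lemma ratio_ne_zero {K : ℕ} (hK : K ≠ 0) : (K / (K + 1) : ℝ) ≠ 0 := by positivity

lemma ratio_sq_lt_one (K : ℕ) : (K / (K + 1) : ℝ) ^ 2 < 1 := by
  have : (K / (K + 1) : ℝ) < 1 := by rw [div_lt_one (by positivity)]; linarith
  have : 0 ≤ (K / (K + 1) : ℝ) := by positivity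
  nlinarith

lemma shiftProd_absolutelyContinuous (hn : 1 ≤ n) {K : ℕ} (hK : K ≠ 0) (μ : ℝ) :
    shiftProd n K μ ≪ stdProd n := by
  have h := (gaussianShift_absolutelyContinuous
    (μ • EuclideanSpace.single (⟨n - 1, by omega⟩ : Fin n) (1 : ℝ)) (ratio_ne_zero hK))
  rw [← map_toLp_shiftProd hn, ← map_toLp_stdProd] at h
  have := h.map (MeasurableEquiv.toLp 2 (Fin n → ℝ)).symm.measurable
  rwa [MeasurableEquiv.map_symm_map, MeasurableEquiv.map_symm_map] at this

lemma exists_toReal_rnDeriv_shiftProd_le (hn : 1 ≤ n) {K : ℕ} (hK : K ≠ 0) (μ : ℝ) :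
    ∃ M : ℝ, ∀ᵐ y ∂(stdProd n), ((shiftProd n K μ).rnDeriv (stdProd n) y).toReal ≤ M := by
  set e := MeasurableEquiv.toLp 2 (Fin n → ℝ)
  set v : EuclideanSpace ℝ (Fin n) := μ • EuclideanSpace.single ⟨n - 1, by omega⟩ 1
  refine ⟨gaussianLR v (K / (K + 1)) ((1 - (K / (K + 1) : ℝ) ^ 2)⁻¹ • v), ?_⟩
  have h1 := toReal_rnDeriv_gaussianShift v (ratio_ne_zero hK)
  have h2 := e.measurableEmbedding.rnDeriv_map (shiftProd n K μ) (stdProd n)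
  rw [← map_toLp_stdProd] at h1
  have h3 := ae_of_ae_map e.measurable.aemeasurable h1
  rw [map_toLp_stdProd, map_toLp_shiftProd hn] at h2
  rw [map_toLp_stdProd] at h3
  filter_upwards [h2, h3] with y hy hy'
  rw [← hy, hy']
  exact gaussianLR_le _ (ratio_ne_zero hK) (ratio_sq_lt_one K) _

/-- For `K = 0`, the alternative is a point mass, which the null hypothesis does not charge. -/
lemma exists_shiftProd_zero_singleton (hn : 1 ≤ n) (μ : ℝ) :
    ∃ x : Fin n → ℝ, stdProd n {x} = 0 ∧ shiftProd n 0 μ {x}ᶜ = 0 := by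
  have : Nonempty (Fin n) := ⟨⟨0, hn⟩⟩
  have hna : NullSingletonClass (gaussianReal 0 1) := nullSingletonClass_gaussianReal one_ne_zero
  refine ⟨fun i => if (i : ℕ) + 1 = n then μ else 0, ?_, ?_⟩
  · unfold stdProd; exact measure_singleton _
  · rw [prob_compl_eq_zero_iff (measurableSet_singleton _), ← Set.univ_pi_singleton, shiftProd,
      Measure.pi_pi]
    simp

lemma rnDeriv_shiftProd_zero (hn : 1 ≤ n) (μ : ℝ) :
    (shiftProd n 0 μ).rnDeriv (stdProd n) =ᵐ[stdProd n] 0 := by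
  obtain ⟨x, h1, h2⟩ := exists_shiftProd_zero_singleton hn μ
  exact Measure.MutuallySingular.rnDeriv_ae_eq_zero
    ⟨{x}ᶜ, (measurableSet_singleton x).compl, h2, by rwa [compl_compl]⟩

lemma tradeOff_shiftProd_zero (hn : 1 ≤ n) (μ : ℝ) {α : ℝ} (hα : 0 ≤ α) :
    tradeOff (stdProd n) (shiftProd n 0 μ) α = 0 := by
  obtain ⟨x, h1, h2⟩ := exists_shiftProd_zero_singleton hn μ
  refine le_antisymm ?_ (tradeOff_nonneg hα)
  -- Rejecting exactly at the atom of the alternative makes both errors zero.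
  have hφ : IsTest (({x} : Set (Fin n → ℝ)).indicator fun _ => (1 : ℝ)) :=
    ⟨measurable_const.indicator (measurableSet_singleton x), fun y => by
      by_cases h : y ∈ ({x} : Set (Fin n → ℝ)) <;> simp [h]⟩
  refine (tradeOff_le hφ ?_).trans_eq ?_
  · rw [integral_indicator_const _ (measurableSet_singleton x), measureReal_def, h1]
    simpa using hα
  · rw [hφ.integral_one_sub, integral_indicator_const _ (measurableSet_singleton x)]
    have : shiftProd n 0 μ {x} = 1 :=
      (prob_compl_eq_zero_iff (measurableSet_singleton x)).1 h2
    simp [measureReal_def, this]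

end ShiftProd

/-! ### The guarantee when the normalization factor increases by one. -/

section Theorem

variable {X : Type*} {n N K : ℕ} {q C σ : ℝ}

/-- The probability of a batch together with the indicator of sampling the added point. -/
noncomputable def pairProb (q : ℝ) (i : Finset (Fin N) × Bool) : ℝ :=
  batchProb q i.1 * cond i.2 q (1 - q)

/-- The bound on the shift of the mean for a batch together with the indicator of sampling the
added point. -/
noncomputable def pairShift (K : ℕ) (σ : ℝ) (i : Finset (Fin N) × Bool) : ℝ :=
  cond i.2 (muBar2 K σ i.1) (muBar1 K σ i.1)

lemma sum_pairProb_mul (q : ℝ) (f : Finset (Fin N) × Bool → ℝ) :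
    ∑ i, pairProb q i * f i =
      ∑ B, batchProb q B * ((1 - q) * f (B, false) + q * f (B, true)) := by
  rw [Fintype.sum_prod_type]
  refine Finset.sum_congr rfl fun B _ => ?_
  simp only [pairProb, Fintype.sum_bool, cond_true, cond_false]
  ring

lemma pairProb_nonneg (hq0 : 0 ≤ q) (hq1 : q ≤ 1) (i : Finset (Fin N) × Bool) :
    0 ≤ pairProb q i := by
  refine mul_nonneg (batchProb_nonneg hq0 hq1 _) ?_
  rcases i with ⟨B, _ | _⟩ <;> simp <;> linarith

lemma sum_pairProb (q : ℝ) (N : ℕ) : ∑ i : Finset (Fin N) × Bool, pairProb q i = 1 := by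
  have := sum_pairProb_mul (N := N) q fun _ => 1
  simp only [mul_one, sub_add_cancel, sum_batchProb] at this
  exact this

lemma mixAlpha_eq (n N K : ℕ) (q σ t c : ℝ) :
    mixAlpha n N K q σ t c = ∑ i : Finset (Fin N) × Bool,
      pairProb q i * lrTypeI (stdProd n) (shiftProd n K (pairShift K σ i)) t c :=
  (sum_pairProb_mul q fun i =>
    lrTypeI (stdProd n) (shiftProd n K (pairShift K σ i)) t c).symm

lemma mixBeta_eq (n N K : ℕ) (q σ t c : ℝ) :
    mixBeta n N K q σ t c = ∑ i : Finset (Fin N) × Bool,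
      pairProb q i * tradeOff (stdProd n) (shiftProd n K (pairShift K σ i))
        (lrTypeI (stdProd n) (shiftProd n K (pairShift K σ i)) t c) :=
  (sum_pairProb_mul q fun i => tradeOff (stdProd n) (shiftProd n K (pairShift K σ i))
    (lrTypeI (stdProd n) (shiftProd n K (pairShift K σ i)) t c)).symm

lemma exists_mixAlpha_eq (hn : 1 ≤ n) (N K : ℕ) (hq0 : 0 ≤ q) (hq1 : q ≤ 1) (σ : ℝ) {α : ℝ}
    (hα : α ∈ Set.Icc (0 : ℝ) 1) :
    ∃ t c : ℝ, 0 ≤ t ∧ c ∈ Set.Icc (0 : ℝ) 1 ∧ mixAlpha n N K q σ t c = α := by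
  have hb (i : Finset (Fin N) × Bool) : ∃ M : ℝ, ∀ᵐ y ∂(stdProd n),
      ((shiftProd n K (pairShift K σ i)).rnDeriv (stdProd n) y).toReal ≤ M := by
    -- For `K = 0` the likelihood ratio vanishes almost everywhere under the null hypothesis, so the
    -- bound is `0`.
    rcases eq_or_ne K 0 with rfl | hK
    · refine ⟨0, ?_⟩
      filter_upwards [rnDeriv_shiftProd_zero hn (pairShift 0 σ i)] with y hy
      simp [hy]
    · exact exists_toReal_rnDeriv_shiftProd_le hn hK _
  choose M hM using hb
  obtain ⟨M', hM'⟩ := Finite.exists_le M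
  simp only [mixAlpha_eq]
  exact exists_sum_lrTypeI_eq (pairProb_nonneg hq0 hq1) (sum_pairProb q N)
    (fun i => (hM i).mono fun y hy => hy.trans (hM' i)) hα

lemma isTradeOffFunction_zero : IsTradeOffFunction fun _ => 0 := by
  refine ⟨Bool, inferInstance, Measure.dirac false, Measure.dirac true, inferInstance,
    inferInstance, fun α hα => le_antisymm (tradeOff_nonneg hα.1) ?_⟩
  have hφ : IsTest (fun b : Bool => cond b (1 : ℝ) 0) :=
    ⟨measurable_of_finite _, fun b => by cases b <;> simp⟩
  refine (tradeOff_le hφ ?_).trans_eq ?_ <;> simp [hα.1]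

lemma mixBeta_zero (hn : 1 ≤ n) (N : ℕ) (q σ t : ℝ) {c : ℝ} (hc : c ∈ Set.Icc (0 : ℝ) 1) :
    mixBeta n N 0 q σ t c = 0 := by
  simp [mixBeta_eq, tradeOff_shiftProd_zero hn _ (lrTypeI_mem_Icc hc).1]

lemma isPrivacyGuarantee_zero {Y : Type*} [MeasurableSpace Y]
    (M : (N : ℕ) → (Fin N → X) → Measure Y) (N : ℕ) : IsPrivacyGuarantee M N fun _ => 0 :=
  ⟨isTradeOffFunction_zero, fun _ _ _ hα => tradeOff_nonneg hα.1⟩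

/-- The trade-off function of the mixture of the pairs of Gaussian laws over all batches. -/
noncomputable def batchTradeOff (n N K : ℕ) (q σ : ℝ) : ℝ → ℝ :=
  letI : MeasurableSpace (Finset (Fin N) × Bool) := ⊤
  tradeOff (mixture (pairProb q) fun _ : Finset (Fin N) × Bool => stdProd n)
    (mixture (pairProb q) fun i : Finset (Fin N) × Bool => shiftProd n K (pairShift K σ i))

lemma isTradeOffFunction_batchTradeOff (n N K : ℕ) (hq0 : 0 ≤ q) (hq1 : q ≤ 1) (σ : ℝ) :
    IsTradeOffFunction (batchTradeOff n N K q σ) :=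
  letI : MeasurableSpace (Finset (Fin N) × Bool) := ⊤
  ⟨_, _, _, _, isProbabilityMeasure_mixture (pairProb_nonneg hq0 hq1) (sum_pairProb q N) _,
    isProbabilityMeasure_mixture (pairProb_nonneg hq0 hq1) (sum_pairProb q N) _, fun _ _ => rfl⟩

lemma batchTradeOff_mixAlpha (hn : 1 ≤ n) (N : ℕ) (hK : K ≠ 0) (hq0 : 0 ≤ q) (hq1 : q ≤ 1)
    (σ : ℝ) {t c : ℝ} (ht : 0 ≤ t) (hc : c ∈ Set.Icc (0 : ℝ) 1) :
    batchTradeOff n N K q σ (mixAlpha n N K q σ t c) = mixBeta n N K q σ t c := by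
  let _ : MeasurableSpace (Finset (Fin N) × Bool) := ⊤
  rw [mixAlpha_eq, mixBeta_eq]
  exact tradeOff_mixture_lrTypeI (pairProb_nonneg hq0 hq1)
    (fun i => shiftProd_absolutelyContinuous hn hK _) ht hc

/-- In units of the null standard deviation `σ C / K`, the alternative has standard deviation `K /
(K + 1)` and its mean is displaced by at most `r`. -/
lemma tradeOff_stdProd_shiftProd_le (hn : 1 ≤ n) (hK : K ≠ 0) (hC : 0 < C) (hσ : 0 < σ)
    {v v' : EuclideanSpace ℝ (Fin n)} {r : ℝ}
    (h : ‖((K : ℝ) + 1)⁻¹ • v' - (K : ℝ)⁻¹ • v‖ ≤ (K : ℝ)⁻¹ * (σ * C) * r) {α : ℝ}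
    (hα : α ∈ Set.Icc (0 : ℝ) 1) :
    tradeOff (stdProd n) (shiftProd n K r) α ≤
      tradeOff (gaussianShift ((K : ℝ)⁻¹ • v) ((K : ℝ)⁻¹ * (σ * C)))
        (gaussianShift (((K : ℝ) + 1)⁻¹ • v') (((K : ℝ) + 1)⁻¹ * (σ * C))) α := by
  have hK' : (0 : ℝ) < K := by positivity
  rw [tradeOff_stdProd_shiftProd hn K r hα.1]
  refine (tradeOff_gaussianShift_le_of_norm_sub_le (by simp) (by positivity) (ratio_ne_zero hK)
    (ratio_sq_lt_one K) h hα).trans_eq ?_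
  congr 2
  field_simp

/-- A test of the output has errors that average its errors on the components. Each component is
dominated by its worst shift, and a tester who also sees the batch and the sampling of the added
point does at least as well. -/
lemma isPrivacyGuarantee_batchTradeOff (hn : 1 ≤ n) (hK : K ≠ 0) (hq0 : 0 ≤ q) (hq1 : q ≤ 1)
    (hC : 0 < C) (hσ : 0 < σ) (g : X → EuclideanSpace ℝ (Fin n))
    (hF : floorFactor q N = K) (hF' : floorFactor q (N + 1) = K + 1) :
    IsPrivacyGuarantee (feasgm q C σ g) N (batchTradeOff n N K q σ) := by
  refine ⟨isTradeOffFunction_batchTradeOff n N K hq0 hq1 σ, fun D d α hα => ?_⟩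
  refine le_tradeOff hα.1 fun φ hφ h => ?_
  rw [integral_feasgm hq0 hq1 g D hφ, hF] at h
  rw [integral_feasgm_snoc hq0 hq1 g D d hφ.one_sub, hF']
  have hK' : (0 : ℝ) < K := by positivity
  set m : Finset (Fin N) → EuclideanSpace ℝ (Fin n) := fun B => ∑ i ∈ B, clip C (g (D i)) with hm
  set a : Finset (Fin N) → ℝ := fun B =>
    ∫ y, φ y ∂(gaussianShift ((K : ℝ)⁻¹ • m B) ((K : ℝ)⁻¹ * (σ * C)))
  have ha (B) : a B ∈ Set.Icc (0 : ℝ) 1 := ⟨hφ.integral_nonneg _, hφ.integral_le_one _⟩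
  have hmB (B) : ‖m B‖ ≤ B.card * C := norm_sum_clip_le hC B fun i => g (D i)
  -- Renormalizing alone moves the mean by `(1/K - 1/(K+1)) m B`, whence the factor `1/(K(K+1))`.
  -- The vector `w` is zero or the added contribution.
  have hsub (B) (w : EuclideanSpace ℝ (Fin n)) : ‖((K : ℝ) + 1)⁻¹ • (m B + w) - (K : ℝ)⁻¹ • m B‖ ≤
      ((K : ℝ) + 1)⁻¹ * ‖w‖ + (K * (K + 1) : ℝ)⁻¹ * (B.card * C) := by
    have : ((K : ℝ) + 1)⁻¹ • (m B + w) - (K : ℝ)⁻¹ • m B =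
        ((K : ℝ) + 1)⁻¹ • w - (K * (K + 1) : ℝ)⁻¹ • m B := by
      have e : (K * (K + 1) : ℝ)⁻¹ = (K : ℝ)⁻¹ - ((K : ℝ) + 1)⁻¹ := by field_simp; ring
      rw [e]; module
    rw [this]
    refine (norm_sub_le _ _).trans ?_
    rw [norm_smul, norm_smul, Real.norm_of_nonneg (by positivity),
      Real.norm_of_nonneg (by positivity)]
    gcongr
    exact hmB B
  have h1 (B) : tradeOff (stdProd n) (shiftProd n K (muBar1 K σ B)) (a B) ≤
      ∫ y, (1 - φ y) ∂(gaussianShift (((K : ℝ) + 1)⁻¹ • m B) (((K : ℝ) + 1)⁻¹ * (σ * C))) := by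
    refine (tradeOff_stdProd_shiftProd_le hn hK hC hσ ?_ (ha B)).trans (tradeOff_le hφ le_rfl)
    have := hsub B 0
    rw [add_zero, norm_zero, mul_zero, zero_add] at this
    refine this.trans_eq ?_
    rw [muBar1]; field_simp
  have h2 (B) : tradeOff (stdProd n) (shiftProd n K (muBar2 K σ B)) (a B) ≤
      ∫ y, (1 - φ y) ∂(gaussianShift (((K : ℝ) + 1)⁻¹ • (m B + clip C (g d)))
        (((K : ℝ) + 1)⁻¹ * (σ * C))) := by
    refine (tradeOff_stdProd_shiftProd_le hn hK hC hσ ?_ (ha B)).trans (tradeOff_le hφ le_rfl)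
    refine (hsub B (clip C (g d))).trans ?_
    have e : (K : ℝ)⁻¹ * (σ * C) * muBar2 K σ B =
        ((K : ℝ) + 1)⁻¹ * C + (K * (K + 1) : ℝ)⁻¹ * (B.card * C) := by
      rw [muBar2]; field_simp
    rw [e]
    gcongr
    exact norm_clip_le hC _
  let _ : MeasurableSpace (Finset (Fin N) × Bool) := ⊤
  -- The null component does not depend on whether the added point is sampled, so both cases receive
  -- the type I error `a B` and the total stays at most `α`.
  refine (tradeOff_mixture_le (pairProb_nonneg hq0 hq1) _ _ (a := fun i => a i.1)
    (fun i => (ha i.1).1) ?_).trans ?_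
  · rw [sum_pairProb_mul]
    simpa only [← add_mul, sub_add_cancel, one_mul] using h
  · rw [sum_pairProb_mul]
    refine Finset.sum_le_sum fun B _ =>
      mul_le_mul_of_nonneg_left ?_ (batchProb_nonneg hq0 hq1 B)
    exact add_le_add (mul_le_mul_of_nonneg_left (h1 B) (sub_nonneg.2 hq1))
      (mul_le_mul_of_nonneg_left (h2 B) hq0)

end Theorem

theorem mainTheorem9 {X : Type*} (n N : ℕ) (hn : 1 ≤ n) (q C σ : ℝ)
    (hq0 : 0 ≤ q) (hq1 : q ≤ 1) (hC : 0 < C) (hσ : 0 < σ)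
    (g : X → EuclideanSpace ℝ (Fin n)) :
    (⌊(N : ℝ) * q⌋₊ = ⌊((N : ℝ) + 1) * q⌋₊ →
      IsPrivacyGuarantee (feasgm q C σ g) N
        (fun α => q * gaussianTradeOff (1 / σ) α + (1 - q) * idTradeOff α)) ∧
    (∀ K : ℕ, ⌊(N : ℝ) * q⌋₊ = K → ⌊((N : ℝ) + 1) * q⌋₊ = K + 1 →
      (∀ α ∈ Set.Icc (0 : ℝ) 1, ∃ t c : ℝ, 0 ≤ t ∧ c ∈ Set.Icc (0 : ℝ) 1 ∧
        mixAlpha n N K q σ t c = α) ∧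
      ∃ f : ℝ → ℝ,
        (∀ t c : ℝ, 0 ≤ t → c ∈ Set.Icc (0 : ℝ) 1 →
          f (mixAlpha n N K q σ t c) = mixBeta n N K q σ t c) ∧
        IsPrivacyGuarantee (feasgm q C σ g) N f) := by
  refine ⟨fun h => isPrivacyGuarantee_feasgm_of_floor_eq hq0 hq1 hC hσ g ?_,
    fun K h h' => ⟨fun α hα => exists_mixAlpha_eq hn N K hq0 hq1 σ hα, ?_⟩⟩
  · rw [floorFactor, floorFactor, Nat.cast_add_one, h]
  -- For `K = 0` every component trade-off is zero, so the zero function satisfies the equation and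
  -- is trivially a guarantee. For `K ≥ 1` the replacement of a zero factor by `1` is inactive.
  · rcases eq_or_ne K 0 with rfl | hK
    · exact ⟨fun _ => 0, fun t c _ hc => (mixBeta_zero hn N q σ t hc).symm,
        isPrivacyGuarantee_zero _ N⟩
    · refine ⟨batchTradeOff n N K q σ,
        fun t c ht hc => batchTradeOff_mixAlpha hn N hK hq0 hq1 σ ht hc,
        isPrivacyGuarantee_batchTradeOff hn hK hq0 hq1 hC hσ g ?_ ?_⟩
      · rw [floorFactor, h, max_eq_left (Nat.one_le_iff_ne_zero.2 hK)]
      · rw [floorFactor, Nat.cast_add_one, h', max_eq_left (by omega)]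
        push_cast; rfl
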